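/- Let $n\ge 3$ and let $\Omega\subset\mathbb{R}^n$ be a convex domain (a nonempty open convex set). A map $f=f(x+iy)$ from an open set $U\subset\mathbb{C}$ to $\mathbb{R}^n$ is called conformal harmonic if it is harmonic and $|f_x|=|f_y|$, $f_x\cdot f_y=0$ on $U$ (branch points and constant maps are allowed). Let $\mathbb{D}=\{z\in\mathbb{C}:|z|<1\}$. The minimal pseudometric of $\Omega$ is $$g_\Omega(p,v)=\inf\{1/r : r>0,\ \exists f:\mathbb{D}\to\Omega \text{ conformal harmonic},\ f(0)=p,\ f_x(0)=rv\},\qquad p\in\Omega,\ v\in\mathbb{R}^n,$$ and the minimal pseudodistance is $\mathrm{dist}_\Omega(p,q)=\inf_\gamma\int_0^1 g_\Omega(\gamma(t),\gamma'(t))\,dt$, the infimum being over piecewise $C^1$ paths $\gamma:[0,1]\to\Omega$ from $p$ to $q$. The following are equivalent: (a) $\Omega$ is complete hyperbolic, i.e. $(\Omega,\mathrm{dist}_\Omega)$ is a complete metric space; (b) $\Omega$ is hyperbolic, i.e. $\mathrm{dist}_\Omega$ is a distance function ($\mathrm{dist}_\Omega(p,q)=0$ only if $p=q$); (c) $\Omega$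 is weakly hyperbolic, i.e. every conformal harmonic map $\mathbb{C}\to\Omega$ is constant; (d) $\Omega$ does not contain any affine $2$-plane; (e) $\Omega$ does not contain any parabolic minimal surface, i.e. there is no smooth immersion $f:R\to\Omega$ with vanishing mean curvature from a connected smooth surface $R$ (not necessarily orientable; $f$ not necessarily complete, proper or injective) such that $R$ is parabolic in the metric induced by $f$ from the Euclidean metric, where parabolic means that every negative subharmonic function $R\to[-\infty,0)$ is constant. -/

import Mathlib

noncomputable section

namespace MinimalHyperbolicity

open Set Metric MeasureTheory Filter Topology
open scoped ENNReal Manifold ContDiff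

/-! ### Partial derivatives in the plane

The plane `ℝ²` is identified with `ℂ`, with coordinate `z = x + i y`. -/

/-- The partial derivative `∂u/∂x`. -/
def dx {V : Type*} [NormedAddCommGroup V] [NormedSpace ℝ V] (u : ℂ → V) (z : ℂ) : V :=
  fderiv ℝ u z 1

/-- The partial derivative `∂u/∂y`. -/
def dy {V : Type*} [NormedAddCommGroup V] [NormedSpace ℝ V] (u : ℂ → V) (z : ℂ) : V :=
  fderiv ℝ u z Complex.I

section Ambient

variable {E : Type*} [NormedAddCommGroup E] [InnerProductSpace ℝ E]

/-! ### Conformal harmonic maps and the minimal pseudodistance -/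

/-- `f` restricts to a conformal harmonic map from the open set `U` of the plane to `Ω`: it is
harmonic on `U` and at every point of `U` the vectors `f_x`, `f_y` are orthogonal and of the same
length. They may both vanish, so branch points and constant maps are allowed. -/
structure IsConformalHarmonic (f : ℂ → E) (U : Set ℂ) (Ω : Set E) : Prop where
  mapsTo : MapsTo f U Ω
  harmonic : InnerProductSpace.HarmonicOnNhd f U
  norm_eq : ∀ z ∈ U, ‖dx f z‖ = ‖dy f z‖
  inner_eq_zero : ∀ z ∈ U, inner ℝ (dx f z) (dy f z) = 0

/-- The minimal pseudometric of `Ω` at the point `p` on the vector `v`, namely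
`inf {1/r : r > 0, ∃ f : 𝔻 → Ω conformal harmonic, f 0 = p, f_x 0 = r v}`. -/
def minimalPseudometric (Ω : Set E) (p v : E) : ℝ≥0∞ :=
  sInf {s | ∃ r : ℝ, 0 < r ∧ s = ENNReal.ofReal (1 / r) ∧
    ∃ f : ℂ → E, IsConformalHarmonic f (ball 0 1) Ω ∧ f 0 = p ∧ dx f 0 = r • v}

/-- `γ` restricts to a piecewise `C¹` path `[0, 1] → Ω` from `p` to `q`. -/
structure IsPiecewiseC1Path (Ω : Set E) (p q : E) (γ : ℝ → E) : Prop where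
  mapsTo : MapsTo γ (Icc 0 1) Ω
  source : γ 0 = p
  target : γ 1 = q
  piecewise : ∃ (k : ℕ) (t : Fin (k + 1) → ℝ), StrictMono t ∧ t 0 = 0 ∧ t (Fin.last k) = 1 ∧
    ∀ i : Fin k, ContDiffOn ℝ 1 γ (Icc (t i.castSucc) (t i.succ))

/-- The minimal pseudodistance of `Ω`, obtained by integrating the minimal pseudometric
along paths in `Ω`. -/
def minimalDist (Ω : Set E) (p q : E) : ℝ≥0∞ :=
  ⨅ (γ : ℝ → E) (_ : IsPiecewiseC1Path Ω p q γ),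
    ∫⁻ t in Icc (0 : ℝ) 1, minimalPseudometric Ω (γ t) (deriv γ t)

/-- `Ω` is hyperbolic: its minimal pseudodistance is a distance, that is, it separates points. -/
def IsHyperbolic (Ω : Set E) : Prop :=
  ∀ p ∈ Ω, ∀ q ∈ Ω, minimalDist Ω p q = 0 → p = q

/-- `Ω` is complete hyperbolic: its minimal pseudodistance is a distance, for which every Cauchy
sequence in `Ω` converges to a point of `Ω`. -/
def IsCompleteHyperbolic (Ω : Set E) : Prop :=
  IsHyperbolic Ω ∧
    ∀ u : ℕ → E, (∀ k, u k ∈ Ω) →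
      (∀ ε : ℝ≥0∞, 0 < ε → ∃ N, ∀ j ≥ N, ∀ k ≥ N, minimalDist Ω (u j) (u k) < ε) →
      ∃ p ∈ Ω, Tendsto (fun k => minimalDist Ω (u k) p) atTop (𝓝 0)

/-- `Ω` is weakly hyperbolic: every conformal harmonic map `ℂ → Ω` is constant. -/
def IsWeaklyHyperbolic (Ω : Set E) : Prop :=
  ∀ f : ℂ → E, IsConformalHarmonic f univ Ω → ∃ p, ∀ z, f z = p

/-- `Ω` contains an affine `2`-plane. -/
def ContainsAffinePlane (Ω : Set E) : Prop :=
  ∃ P : AffineSubspace ℝ E, Module.finrank ℝ P.direction = 2 ∧ (P : Set E) ⊆ Ω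

/-! ### Surfaces given by a local parametrization `X` of an open set of the plane -/

/-- The coefficient `⟨X_x, X_x⟩` of the induced metric. -/
def metricE (X : ℂ → E) (z : ℂ) : ℝ := inner ℝ (dx X z) (dx X z)

/-- The coefficient `⟨X_x, X_y⟩` of the induced metric. -/
def metricF (X : ℂ → E) (z : ℂ) : ℝ := inner ℝ (dx X z) (dy X z)

/-- The coefficient `⟨X_y, X_y⟩` of the induced metric. -/
def metricG (X : ℂ → E) (z : ℂ) : ℝ := inner ℝ (dy X z) (dy X z)

/-- The area density `√(EG - F²)` of the induced metric. -/
def areaDensity (X : ℂ → E) (z : ℂ) : ℝ :=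
  √(metricE X z * metricG X z - metricF X z ^ 2)

/-- The Laplace-Beltrami operator of the induced metric,
`Δu = W⁻¹ (∂ₓ ((G uₓ - F u_y) / W) + ∂_y ((E u_y - F uₓ) / W))` with `W = √(EG - F²)`. -/
def laplaceBeltrami (X : ℂ → E) (u : ℂ → ℝ) (z : ℂ) : ℝ :=
  (areaDensity X z)⁻¹ *
    (dx (fun w => (metricG X w * dx u w - metricF X w * dy u w) / areaDensity X w) z +
      dy (fun w => (metricE X w * dy u w - metricF X w * dx u w) / areaDensity X w) z)

/-- The mean curvature vector of an immersed `X` vanishes at `z`: it is the normal component of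
`(G X_xx - 2 F X_xy + E X_yy) / (2 (EG - F²))`, so this vector has to be tangential. -/
def MeanCurvatureVanishes (X : ℂ → E) (z : ℂ) : Prop :=
  metricG X z • dx (dx X) z - (2 * metricF X z) • dx (dy X) z + metricE X z • dy (dy X) z ∈
    Submodule.span ℝ {dx X z, dy X z}

end Ambient

/-! ### Immersed surfaces

A surface is a smooth real `2`-manifold, modelled on the plane `ℂ`. It need not be orientable. -/

section Surface

variable {E : Type*} [NormedAddCommGroup E] [InnerProductSpace ℝ E]
variable {R : Type*} [TopologicalSpace R] [ChartedSpace ℂ R]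

/-- `f : R → E` is a smooth immersion with vanishing mean curvature. -/
structure IsMinimalImmersion (f : R → E) : Prop where
  smooth : ContMDiff 𝓘(ℝ, ℂ) 𝓘(ℝ, E) ∞ f
  immersion : ∀ x, Function.Injective (mfderiv 𝓘(ℝ, ℂ) 𝓘(ℝ, E) f x)
  minimal : ∀ e ∈ atlas ℂ R, ∀ z ∈ e.target, MeanCurvatureVanishes (f ∘ e.symm) z

/-- The function `u : R → [-∞, ∞)` is subharmonic in the metric induced by the immersion `f`: it is
upper semicontinuous, and on every closed coordinate disc it lies below each continuous function
`h` that is harmonic in the interior and lies above `u` on the boundary circle. -/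
structure IsSubharmonic (f : R → E) (u : R → EReal) : Prop where
  lt_top : ∀ x, u x < ⊤
  upperSemicontinuous : UpperSemicontinuous u
  le_harmonic : ∀ e ∈ atlas ℂ R, ∀ (c : ℂ) (r : ℝ), 0 < r → closedBall c r ⊆ e.target →
    ∀ h : ℂ → ℝ, ContinuousOn h (closedBall c r) → ContDiffOn ℝ 2 h (ball c r) →
      (∀ z ∈ ball c r, laplaceBeltrami (f ∘ e.symm) h z = 0) →
      (∀ z ∈ sphere c r, u (e.symm z) ≤ (h z : EReal)) →
      ∀ z ∈ ball c r, u (e.symm z) ≤ (h z : EReal)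

/-- `R` is parabolic in the metric induced by the immersion `f`: every negative subharmonic
function is constant. -/
def IsParabolic (f : R → E) : Prop :=
  ∀ u : R → EReal, IsSubharmonic f u → (∀ x, u x < 0) → ∃ c, ∀ x, u x = c

end Surface

/-- `Ω` contains a parabolic minimal surface: there is a minimal immersion into `Ω` of a connected
surface (not necessarily complete, proper or embedded), parabolic in the induced metric. -/
def ContainsParabolicMinimalSurface {E : Type*} [NormedAddCommGroup E] [InnerProductSpace ℝ E]
    (Ω : Set E) : Prop :=
  ∃ (R : Type) (_ : TopologicalSpace R) (_ : T2Space R) (_ : SecondCountableTopology R)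
    (_ : ConnectedSpace R) (_ : ChartedSpace ℂ R) (_ : IsManifold 𝓘(ℝ, ℂ) ∞ R) (f : R → E),
    IsMinimalImmersion f ∧ IsParabolic f ∧ ∀ x, f x ∈ Ω

end MinimalHyperbolicity

end

namespace MinimalHyperbolicity

open Set Metric MeasureTheory Filter Topology
open scoped ENNReal Manifold ContDiff InnerProductSpace

/-! ### Affine reparametrisations, affine discs and the implications that only need explicit maps.
-/

section Affine

variable {E : Type*} [NormedAddCommGroup E] [InnerProductSpace ℝ E]

/-! The implications (a) ⇒ (b) ⇒ (c) ⇒ (d) are soft. If `f` is conformal harmonic on all of `ℂ`, it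
restricts to discs of every radius about every point, so the pseudometric vanishes along the images
of segments and all points of the image are at distance zero from each other. An affine 2-plane is
itself the image of such a map.

The core is (d) ⇒ (a). Convexity supplies many functionals `l` with `l < c` on `Ω`, and any
direction they all annihilate is a direction of lines in `Ω`; without an affine 2-plane their common
kernel has dimension at most one. For a conformal harmonic disc `f`, the function `c - l ∘ f` is
positive and harmonic, so a gradient estimate (`abs_fderiv_le_of_harmonic_pos`) bounds `l(f_x)` and
`l(f_y)` by `6 (c - l(f(0)))`. This has two consequences. First, the pseudometric dominates `|d log
(c - l)| / 6`, so a supporting hyperplane is infinitely far away. Second, a one-dimensional kernel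
does no harm: `f_x, f_y` are orthogonal of equal length, hence if nonzero they span a plane, which
cannot lie in the kernel. By compactness finitely many `l` then control `|f_x|`
(`exists_norm_le_of_conformal`), so where the `c - l` are bounded the pseudometric dominates the
Euclidean norm. Cauchy sequences therefore converge in the Euclidean sense, and the limit stays in
`Ω`.

For (d) ⇒ (e), linear functions on a minimal surface are harmonic (`beltramiOperator_self`), so on a
parabolic surface in `Ω` every functional bounded above on `Ω` is constant, and the tangent planes
lie in the common kernel. For (e) ⇒ (d), an affine plane is a minimal surface, parabolic by
Liouville's theorem for negative subharmonic functions (`BelowHarmonic.eq_const`). -/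

theorem fderiv_comp_affine {V : Type*} [NormedAddCommGroup V] [NormedSpace ℝ V] {f : ℂ → V}
    {a b w : ℂ} (hf : DifferentiableAt ℝ f (a + b * w)) :
    fderiv ℝ (fun w => f (a + b * w)) w =
      (fderiv ℝ f (a + b * w)).comp (ContinuousLinearMap.mul ℝ ℂ b) := by
  have h : HasFDerivAt (fun w : ℂ => a + b * w) (ContinuousLinearMap.mul ℝ ℂ b) w :=
    ((ContinuousLinearMap.mul ℝ ℂ b).hasFDerivAt (x := w)).const_add a
  exact (hf.hasFDerivAt.comp w h).fderiv

theorem fderiv_apply_eq {V : Type*} [NormedAddCommGroup V] [NormedSpace ℝ V] (f : ℂ → V)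
    (z b : ℂ) : fderiv ℝ f z b = b.re • dx f z + b.im • dy f z := by
  conv_lhs => rw [(by simp : b = b.re • (1 : ℂ) + b.im • Complex.I)]
  rw [map_add, map_smul, map_smul]; rfl

/-- Multiplication by `b` is a similarity of the plane, so the trace of the second derivative is
multiplied by `|b|²`: in `D(b, b) + D(ib, ib)` the cross terms cancel. -/
theorem harmonicAt_comp_affine {f : ℂ → E} {a b w : ℂ}
    (hf : InnerProductSpace.HarmonicAt f (a + b * w)) :
    InnerProductSpace.HarmonicAt (fun w => f (a + b * w)) w := by
  have hc : Continuous fun w : ℂ => a + b * w := by fun_prop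
  have key : ∀ w, InnerProductSpace.HarmonicAt f (a + b * w) →
      Laplacian.laplacian (fun w => f (a + b * w)) w = 0 := by
    intro w hw
    have h1 : (fderiv ℝ fun w => f (a + b * w)) =ᶠ[𝓝 w] fun w =>
        (fderiv ℝ f (a + b * w)).comp (ContinuousLinearMap.mul ℝ ℂ b) := by
      filter_upwards [hc.continuousAt.eventually hw.eventually] with v hv
      exact fderiv_comp_affine (hv.1.differentiableAt two_ne_zero)
    have hd : DifferentiableAt ℝ (fderiv ℝ f) (a + b * w) :=
      (hw.1.fderiv_right (m := 1) (by norm_num)).differentiableAt one_ne_zero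
    have hd' : DifferentiableAt ℝ (fun w => fderiv ℝ f (a + b * w)) w :=
      hd.comp w (by fun_prop)
    have h0 := hw.2.eq_of_nhds
    simp only [InnerProductSpace.laplacian_eq_iteratedFDeriv_complexPlane, iteratedFDeriv_two_apply,
      Fin.isValue, Matrix.cons_val_zero, Matrix.cons_val_one, Matrix.cons_val_fin_one,
      Pi.zero_apply] at h0 ⊢
    rw [h1.fderiv_eq, fderiv_clm_comp hd' (by fun_prop), fderiv_comp_affine hd]
    simp only [fderiv_fun_const, Pi.zero_apply, ContinuousLinearMap.comp_zero, zero_add,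
      ContinuousLinearMap.comp_apply, ContinuousLinearMap.mul_apply', mul_one,
      ContinuousLinearMap.compL_apply, ContinuousLinearMap.flip_apply]
    set D := fderiv ℝ (fderiv ℝ f) (a + b * w)
    have e1 : b = b.re • (1 : ℂ) + b.im • Complex.I := by simp
    have e2 : b * Complex.I = (-b.im) • (1 : ℂ) + b.re • Complex.I := by
      apply Complex.ext <;> simp
    rw [e2]
    have : D b b = D (b.re • (1 : ℂ) + b.im • Complex.I) (b.re • (1 : ℂ) + b.im • Complex.I) := by
      rw [← e1]
    rw [this]
    simp only [map_add, map_smul, add_apply, smul_apply]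
    have h2 : D Complex.I Complex.I = - D 1 1 := by
      rw [eq_neg_iff_add_eq_zero, add_comm]; exact h0
    rw [h2]
    module
  refine ⟨hf.1.comp w (by fun_prop), ?_⟩
  filter_upwards [hc.continuousAt.eventually hf.eventually] with v hv
  exact key v hv

theorem IsConformalHarmonic.differentiableAt {f : ℂ → E} {U : Set ℂ} {Ω : Set E}
    (hf : IsConformalHarmonic f U Ω) {z : ℂ} (hz : z ∈ U) : DifferentiableAt ℝ f z :=
  (hf.harmonic z hz).1.differentiableAt two_ne_zero

/-- Conformal harmonic maps are stable under precomposition with complex affine maps. -/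
theorem IsConformalHarmonic.comp_affine {f : ℂ → E} {U V : Set ℂ} {Ω : Set E}
    (hf : IsConformalHarmonic f U Ω) (a b : ℂ) (h : ∀ w ∈ V, a + b * w ∈ U) :
    IsConformalHarmonic (fun w => f (a + b * w)) V Ω := by
  have e1 : ∀ w ∈ V, dx (fun w => f (a + b * w)) w =
      b.re • dx f (a + b * w) + b.im • dy f (a + b * w) := fun w hw => by
    rw [dx, fderiv_comp_affine (hf.differentiableAt (h w hw))]
    simp [fderiv_apply_eq]
  have e2 : ∀ w ∈ V, dy (fun w => f (a + b * w)) w =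
      (-b.im) • dx f (a + b * w) + b.re • dy f (a + b * w) := fun w hw => by
    rw [dy, fderiv_comp_affine (hf.differentiableAt (h w hw))]
    simp [fderiv_apply_eq]
  refine ⟨fun w hw => hf.mapsTo (h w hw), fun w hw => harmonicAt_comp_affine (hf.harmonic _ (h w hw)),
    fun w hw => ?_, fun w hw => ?_⟩
  · have h1 := hf.norm_eq _ (h w hw)
    have h2 := hf.inner_eq_zero _ (h w hw)
    rw [e1 w hw, e2 w hw, ← sq_eq_sq₀ (norm_nonneg _) (norm_nonneg _), norm_add_sq_real,
      norm_add_sq_real]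
    simp only [norm_smul, inner_smul_left, inner_smul_right, h2, h1, mul_pow, norm_neg,
      Real.norm_eq_abs, sq_abs]
    simp; ring
  · have h1 := hf.norm_eq _ (h w hw)
    have h2 := hf.inner_eq_zero _ (h w hw)
    rw [e1 w hw, e2 w hw]
    simp only [inner_add_left, inner_add_right, inner_smul_left, inner_smul_right, h2,
      real_inner_comm (dx f (a + b * w)) (dy f (a + b * w)), real_inner_self_eq_norm_sq, h1]
    simp
    ring

/-- The affine map of the plane with linear part `x + iy ↦ x e₁ + y e₂`. -/
noncomputable def affineDisc (p e₁ e₂ : E) (z : ℂ) : E := p + (z.re • e₁ + z.im • e₂)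

theorem hasFDerivAt_affineDisc (p e₁ e₂ : E) (z : ℂ) :
    HasFDerivAt (affineDisc p e₁ e₂)
      (Complex.reCLM.smulRight e₁ + Complex.imCLM.smulRight e₂) z :=
  ((Complex.reCLM.smulRight e₁ + Complex.imCLM.smulRight e₂).hasFDerivAt (x := z)).const_add p

@[simp] theorem dx_affineDisc (p e₁ e₂ : E) : dx (affineDisc p e₁ e₂) = fun _ => e₁ := by
  ext z; simp [dx, (hasFDerivAt_affineDisc p e₁ e₂ z).fderiv]

@[simp] theorem dy_affineDisc (p e₁ e₂ : E) : dy (affineDisc p e₁ e₂) = fun _ => e₂ := by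
  ext z; simp [dy, (hasFDerivAt_affineDisc p e₁ e₂ z).fderiv]

theorem contDiff_affineDisc (p e₁ e₂ : E) {k : WithTop ℕ∞} : ContDiff ℝ k (affineDisc p e₁ e₂) :=
  contDiff_const.add (Complex.reCLM.smulRight e₁ + Complex.imCLM.smulRight e₂).contDiff

theorem isConformalHarmonic_affineDisc {p e₁ e₂ : E} {U : Set ℂ} {Ω : Set E}
    (hn : ‖e₁‖ = ‖e₂‖) (ho : inner ℝ e₁ e₂ = 0) (h : MapsTo (affineDisc p e₁ e₂) U Ω) :
    IsConformalHarmonic (affineDisc p e₁ e₂) U Ω := by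
  refine ⟨h, fun z _ => ⟨(contDiff_affineDisc p e₁ e₂).contDiffAt, ?_⟩, ?_, ?_⟩
  · have : fderiv ℝ (affineDisc p e₁ e₂) =
        fun _ => Complex.reCLM.smulRight e₁ + Complex.imCLM.smulRight e₂ := by
      ext1 z; exact (hasFDerivAt_affineDisc p e₁ e₂ z).fderiv
    refine Eventually.of_forall fun z => ?_
    simp [InnerProductSpace.laplacian_eq_iteratedFDeriv_complexPlane, iteratedFDeriv_two_apply, this]
  · simp [hn]
  · simp [ho]

theorem minimalPseudometric_eq_zero {Ω : Set E} {p v : E}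
    (h : ∀ r : ℝ, 0 < r → ∃ f : ℂ → E, IsConformalHarmonic f (ball 0 1) Ω ∧ f 0 = p ∧
      dx f 0 = r • v) : minimalPseudometric Ω p v = 0 := by
  refine le_antisymm (le_of_forall_pos_le_add fun ε hε => ?_) zero_le
  by_cases hε' : ε = ⊤
  · simp [hε']
  have hp : 0 < ε.toReal := ENNReal.toReal_pos hε.ne' hε'
  rw [zero_add]
  refine sInf_le ⟨1 / ε.toReal, by positivity, ?_, h _ (by positivity)⟩
  rw [one_div_one_div, ENNReal.ofReal_toReal hε']

/-- The path `t ↦ f(tz)` has length zero: for every `r > 0` the disc `w ↦ f(tz + rzw)` is admissible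
at `f(tz)` and its `x`-derivative at the centre is `r` times the velocity of the path. -/
theorem IsHyperbolic.isWeaklyHyperbolic {Ω : Set E} (h : IsHyperbolic Ω) :
    IsWeaklyHyperbolic Ω := by
  intro f hf
  refine ⟨f 0, fun z => ?_⟩
  refine (h (f 0) (hf.mapsTo trivial) (f z) (hf.mapsTo trivial) ?_).symm
  have hsm : ContDiff ℝ 2 f := contDiff_iff_contDiffAt.2 fun w => (hf.harmonic w trivial).1
  have hline : ContDiff ℝ 2 fun t : ℝ => z * (t : ℂ) :=
    contDiff_const.mul Complex.ofRealCLM.contDiff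
  have hpath : IsPiecewiseC1Path Ω (f 0) (f z) fun t : ℝ => f (z * t) := by
    refine ⟨fun t _ => hf.mapsTo trivial, by simp, by simp, 1, ![0, 1], ?_, rfl, rfl, fun i => ?_⟩
    · intro i j hij; fin_cases i <;> fin_cases j <;> simp_all
    · exact ((hsm.comp hline).of_le (by norm_num)).contDiffOn
  refine le_antisymm (iInf₂_le_of_le _ hpath ?_) zero_le
  rw [nonpos_iff_eq_zero]
  have : ∀ t : ℝ, minimalPseudometric Ω (f (z * t)) (deriv (fun t : ℝ => f (z * t)) t) = 0 := by
    intro t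
    apply minimalPseudometric_eq_zero
    intro r hr
    refine ⟨fun w => f (z * t + r * z * w), hf.comp_affine _ _ fun _ _ => trivial, by simp, ?_⟩
    rw [dx, fderiv_comp_affine (hf.differentiableAt trivial)]
    have hl : HasDerivAt (fun t : ℝ => z * (t : ℂ)) z t := by
      simpa using (Complex.ofRealCLM.hasDerivAt (x := t)).const_mul z
    have := ((hf.differentiableAt (z := z * t) trivial).hasFDerivAt.comp_hasDerivAt t hl).deriv
    simp only [Function.comp_def] at this
    rw [this]
    have e : (r : ℂ) * z = r • z := by simp
    simp only [ContinuousLinearMap.comp_apply, ContinuousLinearMap.mul_apply', mul_one, mul_zero,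
      add_zero]
    rw [e, map_smul]
  simp only [this, lintegral_zero]

theorem exists_orthonormal_basis_of_finrank_two {W : Submodule ℝ E}
    (hW : Module.finrank ℝ W = 2) :
    ∃ e₁ ∈ W, ∃ e₂ ∈ W, ‖e₁‖ = 1 ∧ ‖e₂‖ = 1 ∧ inner ℝ e₁ e₂ = 0 := by
  have : FiniteDimensional ℝ W := Module.finite_of_finrank_eq_succ hW
  let b := (stdOrthonormalBasis ℝ W).reindex (finCongr hW)
  refine ⟨b 0, (b 0).2, b 1, (b 1).2, b.orthonormal.1 0, b.orthonormal.1 1,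
    b.orthonormal.2 (show (0 : Fin 2) ≠ 1 by decide)⟩

/-- An affine plane is the image of a conformal affine map of `ℂ`. -/
theorem ContainsAffinePlane.exists_affineDisc {Ω : Set E} (h : ContainsAffinePlane Ω) :
    ∃ p e₁ e₂ : E, ‖e₁‖ = 1 ∧ ‖e₂‖ = 1 ∧ inner ℝ e₁ e₂ = 0 ∧ ∀ z, affineDisc p e₁ e₂ z ∈ Ω := by
  obtain ⟨P, hP, hPΩ⟩ := h
  obtain ⟨e₁, h₁, e₂, h₂, h⟩ := exists_orthonormal_basis_of_finrank_two hP
  obtain ⟨p, hp⟩ : (P : Set E).Nonempty := by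
    rw [AffineSubspace.nonempty_iff_ne_bot]
    rintro rfl
    rw [AffineSubspace.direction_bot, finrank_bot] at hP
    omega
  refine ⟨p, e₁, e₂, h.1, h.2.1, h.2.2, fun z => hPΩ ?_⟩
  rw [affineDisc, add_comm]
  exact AffineSubspace.vadd_mem_of_mem_direction
    (add_mem (P.direction.smul_mem _ h₁) (P.direction.smul_mem _ h₂)) hp

theorem IsWeaklyHyperbolic.not_containsAffinePlane {Ω : Set E} (h : IsWeaklyHyperbolic Ω) :
    ¬ ContainsAffinePlane Ω := by
  intro hP
  obtain ⟨p, e₁, e₂, h1, h2, ho, hΩ⟩ := hP.exists_affineDisc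
  obtain ⟨q, hq⟩ := h _ (isConformalHarmonic_affineDisc (h1.trans h2.symm) ho fun z _ => hΩ z)
  have := (hq 0).trans (hq 1).symm
  simp [affineDisc] at this
  simp [this] at h1

/-- An orthogonal vector of the same length. -/
theorem exists_orthogonal_norm_eq [FiniteDimensional ℝ E] (h : 2 ≤ Module.finrank ℝ E) (v : E) :
    ∃ w : E, ‖v‖ = ‖w‖ ∧ inner ℝ v w = 0 := by
  obtain ⟨w, hw, hw0⟩ : ∃ w ∈ (ℝ ∙ v)ᗮ, w ≠ 0 := by
    apply Submodule.exists_mem_ne_zero_of_ne_bot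
    intro hb
    have := Submodule.finrank_add_finrank_orthogonal (ℝ ∙ v)
    rw [hb, finrank_bot] at this
    have := finrank_span_le_card (R := ℝ) ({v} : Set E)
    rw [Set.toFinset_card, Fintype.card_unique] at this
    omega
  refine ⟨(‖v‖ / ‖w‖) • w, ?_, ?_⟩
  · rw [norm_smul, norm_div, norm_norm, norm_norm, div_mul_cancel₀ _ (norm_ne_zero_iff.2 hw0)]
  · rw [inner_smul_right, Submodule.mem_orthogonal_singleton_iff_inner_right.1 hw, mul_zero]

/-- The competitor is the flat disc spanned by `v` and an orthogonal vector of equal length. The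
factor `2` comes from the crude bound `|x| + |y| < 2` on the unit disc. -/
theorem minimalPseudometric_le [FiniteDimensional ℝ E] (hE : 2 ≤ Module.finrank ℝ E) {Ω : Set E}
    {p : E} {r : ℝ} (hr : 0 < r) (h : ball p r ⊆ Ω) (v : E) :
    minimalPseudometric Ω p v ≤ ENNReal.ofReal (2 * ‖v‖ / r) := by
  obtain ⟨w, hw, ho⟩ := exists_orthogonal_norm_eq hE v
  have key : ∀ s : ℝ, 0 < s → 2 * (s * ‖v‖) ≤ r → ∃ f : ℂ → E, IsConformalHarmonic f (ball 0 1) Ω ∧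
      f 0 = p ∧ dx f 0 = s • v := by
    intro s hs hsr
    refine ⟨affineDisc p (s • v) (s • w), isConformalHarmonic_affineDisc (by simp [norm_smul, hw])
      (by simp [inner_smul_left, inner_smul_right, ho]) fun z hz => h ?_, by simp [affineDisc],
      by simp⟩
    rw [mem_ball_zero_iff] at hz
    rw [affineDisc, mem_ball, dist_eq_norm, add_sub_cancel_left]
    calc _ ≤ |z.re| * (s * ‖v‖) + |z.im| * (s * ‖v‖) := by
          refine (norm_add_le _ _).trans (le_of_eq ?_)
          simp [norm_smul, abs_of_pos hs, hw]
      _ < r := by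
        rcases (norm_nonneg v).eq_or_lt with h0 | h0
        · rw [← h0]; simpa using hr
        have h1 : |z.re| < 1 := (Complex.abs_re_le_norm z).trans_lt hz
        have h2 : |z.im| < 1 := (Complex.abs_im_le_norm z).trans_lt hz
        have : 0 < s * ‖v‖ := by positivity
        nlinarith
  rcases (norm_nonneg v).eq_or_lt with h0 | h0
  · rw [minimalPseudometric_eq_zero fun s hs => key s hs (by rw [← h0]; simpa using hr.le)]
    exact zero_le
  · refine sInf_le ⟨r / (2 * ‖v‖), by positivity, by rw [one_div_div], key _ (by positivity) ?_⟩
    field_simp; exact le_rfl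

theorem minimalDist_le [FiniteDimensional ℝ E] (hE : 2 ≤ Module.finrank ℝ E) {Ω : Set E}
    {p q : E} {r : ℝ} (hr : 0 < r) (h : ball p (2 * r) ⊆ Ω) (hq : q ∈ ball p r) :
    minimalDist Ω q p ≤ ENNReal.ofReal (2 * dist q p / r) := by
  have hmem : ∀ t ∈ Icc (0 : ℝ) 1, AffineMap.lineMap q p t ∈ ball p r := fun t ht =>
    (convex_ball p r).segment_subset hq (mem_ball_self hr)
      (by rw [segment_eq_image_lineMap]; exact ⟨t, ht, rfl⟩)
  have hb : ∀ x ∈ ball p r, ball x r ⊆ Ω := fun x hx =>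
    (ball_subset_ball' (by rw [mem_ball] at hx; linarith)).trans h
  have hpath : IsPiecewiseC1Path Ω q p (AffineMap.lineMap q p : ℝ → E) := by
    refine ⟨fun t ht => hb _ (hmem t ht) (mem_ball_self hr), by simp, by simp, 1, ![0, 1],
      ?_, rfl, rfl, fun i => ?_⟩
    · intro i j hij; fin_cases i <;> fin_cases j <;> simp_all
    · exact ContDiff.contDiffOn (by
        have : (AffineMap.lineMap q p : ℝ → E) = fun t => t • (p - q) + q := by
          ext1 t; rw [AffineMap.lineMap_apply, vsub_eq_sub, vadd_eq_add]
        rw [this]; fun_prop)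
  refine iInf₂_le_of_le _ hpath ?_
  calc _ ≤ ∫⁻ t in Icc (0 : ℝ) 1, ENNReal.ofReal (2 * dist q p / r) := by
        refine setLIntegral_mono measurable_const fun t ht => ?_
        refine (minimalPseudometric_le hE hr (hb _ (hmem t ht)) _).trans ?_
        rw [(AffineMap.hasDerivAt_lineMap (a := q) (b := p) (x := t)).deriv, dist_comm, dist_eq_norm]
    _ = _ := by simp

end Affine

/-- Gradient estimate for positive harmonic functions on the unit disc. -/
theorem abs_fderiv_le_of_harmonic_pos {u : ℂ → ℝ}
    (hu : InnerProductSpace.HarmonicOnNhd u (ball 0 1)) (hpos : ∀ z ∈ ball (0 : ℂ) 1, 0 < u z)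
    (v : ℂ) : |fderiv ℝ u 0 v| ≤ 6 * u 0 * ‖v‖ := by
  obtain ⟨F, hF, hFu⟩ := hu.exists_analyticOnNhd_ball_re_eq
  have h0 : (0 : ℂ) ∈ ball (0 : ℂ) 1 := by simp
  have hd : DifferentiableAt ℂ F 0 := (hF 0 h0).differentiableAt
  have hu0 := hpos 0 h0
  have e1 : fderiv ℝ u 0 v = (deriv F 0 * v).re := by
    have h1 : HasFDerivAt (fun z => (F z).re) _ (0 : ℂ) :=
      Complex.reCLM.hasFDerivAt.comp 0 (hd.hasDerivAt.hasFDerivAt.restrictScalars ℝ)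
    have h2 : u =ᶠ[𝓝 0] fun z => (F z).re := by
      filter_upwards [isOpen_ball.mem_nhds h0] with z hz using (hFu hz).symm
    rw [h2.fderiv_eq, h1.fderiv]
    simp [mul_comm]
  have hsub : closedBall (0 : ℂ) (1 / 2) ⊆ ball 0 1 := closedBall_subset_ball (by norm_num)
  -- With `u = Re F`, the function `exp(-F / u(0))` has modulus at most `1`, and modulus `e⁻¹` at
  -- the centre. Cauchy's estimate on the circle of radius `1/2` gives `e⁻¹ |F'(0)| / u(0) ≤ 2`, and
  -- `2e ≤ 6`.
  have hG : ‖deriv (fun z => Complex.exp (-((u 0)⁻¹ : ℝ) * F z)) 0‖ ≤ 1 / (1 / 2) := by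
    refine Complex.norm_deriv_le_of_forall_mem_sphere_norm_le (by norm_num) ?_ fun z hz => ?_
    · refine DifferentiableOn.diffContOnCl fun z hz => ?_
      rw [closure_ball _ (by norm_num)] at hz
      have := (hF z (hsub hz)).differentiableAt
      exact DifferentiableAt.differentiableWithinAt (by fun_prop)
    · have hz' := hsub (sphere_subset_closedBall hz)
      rw [Complex.norm_exp, Real.exp_le_one_iff]
      have h1 : (F z).re = u z := hFu hz'
      have h2 := hpos z hz'
      have : (-((u 0)⁻¹ : ℝ) * F z : ℂ).re = -((u 0)⁻¹ * u z) := by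
        rw [← Complex.ofReal_neg, Complex.re_ofReal_mul, h1]; ring
      rw [this]
      have : 0 < (u 0)⁻¹ * u z := by positivity
      linarith
  have hG' : deriv (fun z => Complex.exp (-((u 0)⁻¹ : ℝ) * F z)) 0 =
      Complex.exp (-((u 0)⁻¹ : ℝ) * F 0) * (-((u 0)⁻¹ : ℝ) * deriv F 0) :=
    (hd.hasDerivAt.const_mul _).cexp.deriv
  have hre : (-((u 0)⁻¹ : ℝ) * F 0 : ℂ).re = -1 := by
    have h1 : (F 0).re = u 0 := hFu h0
    rw [← Complex.ofReal_neg, Complex.re_ofReal_mul, h1]; field_simp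
  rw [hG', norm_mul, Complex.norm_exp, hre, norm_mul, norm_neg, Complex.norm_real, norm_inv,
    Real.norm_of_nonneg hu0.le] at hG
  have hexp : Real.exp (-1) * 3 ≥ 1 := by
    rw [Real.exp_neg]
    have := Real.exp_one_lt_d9
    have h3 : Real.exp 1 ≤ 3 := by linarith
    rw [ge_iff_le, inv_mul_eq_div, one_le_div (Real.exp_pos 1)]
    exact h3
  have hder : ‖deriv F 0‖ ≤ 6 * u 0 := by
    have e : ‖deriv F 0‖ = u 0 * ((u 0)⁻¹ * ‖deriv F 0‖) := by field_simp
    have hn : 0 ≤ (u 0)⁻¹ * ‖deriv F 0‖ := by positivity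
    have : (u 0)⁻¹ * ‖deriv F 0‖ ≤ 6 := by nlinarith
    rw [e]; nlinarith
  rw [e1]
  calc _ ≤ ‖deriv F 0 * v‖ := Complex.abs_re_le_norm _
    _ = ‖deriv F 0‖ * ‖v‖ := norm_mul _ _
    _ ≤ _ := by gcongr

/-! ### Functionals bounded above on a convex domain, and infinitesimal lower bounds. -/

section Barrier

variable {E : Type*} [NormedAddCommGroup E] [InnerProductSpace ℝ E]

/-- The linear functionals that are bounded above on `Ω`. -/
def barrier (Ω : Set E) : Set E := {l | ∃ c : ℝ, ∀ x ∈ Ω, inner ℝ l x < c}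

theorem exists_support [CompleteSpace E] {Ω : Set E} (hopen : IsOpen Ω) (hconvex : Convex ℝ Ω)
    {p : E} (hp : p ∉ Ω) : ∃ l : E, ∀ x ∈ Ω, inner ℝ l x < inner ℝ l p := by
  obtain ⟨f, hf⟩ := geometric_hahn_banach_open_point hconvex hopen hp
  exact ⟨(InnerProductSpace.toDual ℝ E).symm f, by simpa using hf⟩

/-- If the plane through `p ∈ Ω` spanned by `v, w` left `Ω` at `x`, a functional separating `x` from
`Ω` would belong to the barrier, hence be constant on that plane, although it is strictly smaller at
`p` than at `x`. -/
theorem linearIndependent_orthogonal_barrier [CompleteSpace E] {Ω : Set E} (hopen : IsOpen Ω)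
    (hconvex : Convex ℝ Ω) (hne : Ω.Nonempty) (hP : ¬ ContainsAffinePlane Ω) {v w : E}
    (hv : ∀ l ∈ barrier Ω, inner ℝ l v = 0) (hw : ∀ l ∈ barrier Ω, inner ℝ l w = 0) :
    ¬ LinearIndependent ℝ ![v, w] := by
  intro hli
  obtain ⟨p, hp⟩ := hne
  refine hP ⟨AffineSubspace.mk' p (Submodule.span ℝ (range ![v, w])), ?_, fun x hx => ?_⟩
  · rw [AffineSubspace.direction_mk', finrank_span_eq_card hli, Fintype.card_fin]
  · by_contra hxΩ
    obtain ⟨l, hl⟩ := exists_support hopen hconvex hxΩ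
    have hlb : l ∈ barrier Ω := ⟨_, hl⟩
    have hx' : x - p ∈ Submodule.span ℝ (range ![v, w]) := by
      rw [SetLike.mem_coe, AffineSubspace.mem_mk'] at hx
      simpa using hx
    have : ∀ y ∈ Submodule.span ℝ (range ![v, w]), inner ℝ l y = 0 := by
      intro y hy
      induction hy using Submodule.span_induction with
      | mem y hy =>
        obtain ⟨i, rfl⟩ := hy
        fin_cases i
        · exact hv l hlb
        · exact hw l hlb
      | zero => simp
      | add a b _ _ ha hb => rw [inner_add_right, ha, hb, add_zero]
      | smul a b _ hb => rw [inner_smul_right, hb, mul_zero]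
    have h1 := this _ hx'
    rw [inner_sub_right] at h1
    linarith [hl p hp]

/-- A maximal independent subset of the barrier has the same span, hence the same annihilator.
Finiteness is what allows uniform constants later. -/
theorem exists_finite_barrier [FiniteDimensional ℝ E] (Ω : Set E) :
    ∃ b : Finset E, (b : Set E) ⊆ barrier Ω ∧
      ∀ v, (∀ l ∈ b, inner ℝ l v = 0) → ∀ l ∈ barrier Ω, inner ℝ l v = 0 := by
  obtain ⟨b, hb, hspan, hli⟩ := exists_linearIndependent ℝ (barrier Ω)
  have hfin : b.Finite := hli.setFinite
  refine ⟨hfin.toFinset, by simpa using hb, fun v hv l hl => ?_⟩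
  have hl' : l ∈ Submodule.span ℝ b := hspan ▸ Submodule.subset_span hl
  clear hl
  induction hl' using Submodule.span_induction with
  | mem y hy => exact hv y (by simpa using hy)
  | zero => simp
  | add a b _ _ ha hb => rw [inner_add_left, ha, hb, add_zero]
  | smul a b _ hb => rw [inner_smul_left, hb, mul_zero]

/-- If the common kernel of finitely many functionals contains no `2`-plane, they control
conformal pairs of vectors. -/
theorem exists_norm_le_of_conformal [FiniteDimensional ℝ E] (b : Finset E)
    (hb : ∀ v w : E, (∀ l ∈ b, inner ℝ l v = 0) → (∀ l ∈ b, inner ℝ l w = 0) →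
      ¬ LinearIndependent ℝ ![v, w]) :
    ∃ C : ℝ, 0 < C ∧ ∀ (v w : E) (M : ℝ), ‖v‖ = ‖w‖ → inner ℝ v w = 0 →
      (∀ l ∈ b, |inner ℝ l v| ≤ M) → (∀ l ∈ b, |inner ℝ l w| ≤ M) → 0 ≤ M → ‖v‖ ≤ C * M := by
  -- Orthonormal pairs form a compact set. The continuous function `φ` has no zero on it, since a
  -- zero would be an independent pair in the common kernel, so `φ` is bounded below by a positive
  -- constant.
  set S : Set (E × E) := {x | ‖x.1‖ = 1 ∧ ‖x.2‖ = 1 ∧ inner ℝ x.1 x.2 = 0}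
  set φ : E × E → ℝ := fun x => ∑ l ∈ b, (|inner ℝ l x.1| + |inner ℝ l x.2|)
  have hφc : Continuous φ := by fun_prop
  have hSc : IsCompact S := by
    refine ((isCompact_sphere (0 : E) 1).prod (isCompact_sphere (0 : E) 1)).of_isClosed_subset ?_ ?_
    · exact ((isClosed_eq (by fun_prop) (by fun_prop)).inter
        ((isClosed_eq (by fun_prop) (by fun_prop)).inter
          (isClosed_eq (by fun_prop) (by fun_prop))))
    · intro x hx
      simpa using ⟨hx.1, hx.2.1⟩
  have hφpos : ∀ x ∈ S, 0 < φ x := by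
    intro x hx
    have h0 : 0 ≤ φ x := Finset.sum_nonneg fun l _ => by positivity
    refine h0.lt_of_ne fun h => ?_
    have h1 := (Finset.sum_eq_zero_iff_of_nonneg fun l _ => by positivity).1 h.symm
    have h2 : ∀ l ∈ b, inner ℝ l x.1 = 0 ∧ inner ℝ l x.2 = 0 := fun l hl => by
      have := h1 l hl
      have a1 := abs_nonneg (inner ℝ l x.1)
      have a2 := abs_nonneg (inner ℝ l x.2)
      exact ⟨abs_eq_zero.1 (by linarith), abs_eq_zero.1 (by linarith)⟩
    refine hb x.1 x.2 (fun l hl => (h2 l hl).1) (fun l hl => (h2 l hl).2) ?_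
    have : Orthonormal ℝ ![x.1, x.2] := by
      refine ⟨fun i => ?_, fun i j hij => ?_⟩
      · fin_cases i
        exacts [hx.1, hx.2.1]
      · fin_cases i <;> fin_cases j
        exacts [absurd rfl hij, hx.2.2, (real_inner_comm _ _).trans hx.2.2, absurd rfl hij]
    exact this.linearIndependent
  obtain ⟨m, hm, hmS⟩ : ∃ m : ℝ, 0 < m ∧ ∀ x ∈ S, m ≤ φ x := by
    rcases S.eq_empty_or_nonempty with hS | hS
    · exact ⟨1, one_pos, by simp [hS]⟩
    · obtain ⟨x, hx, hmin⟩ := hSc.exists_isMinOn hS hφc.continuousOn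
      exact ⟨φ x, hφpos x hx, hmin⟩
  -- Each `l` contributes at most `2M` to the sum; the `+ 1` keeps the constant positive when `b` is
  -- empty.
  refine ⟨(2 * b.card + 1) / m, by positivity, fun v w M hn ho hv hw hM => ?_⟩
  rcases (norm_nonneg v).eq_or_lt with h0 | h0
  · rw [← h0]; positivity
  have hvw : 0 < ‖w‖ := hn ▸ h0
  have hmem : (‖v‖⁻¹ • v, ‖v‖⁻¹ • w) ∈ S := by
    refine ⟨?_, ?_, ?_⟩
    · simp [norm_smul, h0.ne']
    · simp [norm_smul, hn, hvw.ne']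
    · simp [inner_smul_left, inner_smul_right, ho]
  have h1 := hmS _ hmem
  have h2 : φ (‖v‖⁻¹ • v, ‖v‖⁻¹ • w) ≤ ∑ l ∈ b, ‖v‖⁻¹ * (2 * M) := by
    refine Finset.sum_le_sum fun l hl => ?_
    simp only [inner_smul_right, abs_mul, abs_inv, abs_norm]
    have := hv l hl
    have := hw l hl
    rw [← mul_add]
    gcongr
    linarith
  rw [Finset.sum_const, nsmul_eq_mul] at h2
  rw [div_mul_eq_mul_div, le_div_iff₀ hm]
  have h3 : m ≤ b.card * (‖v‖⁻¹ * (2 * M)) := h1.trans h2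
  have h4 : ‖v‖ * m ≤ ‖v‖ * (b.card * (‖v‖⁻¹ * (2 * M))) := by gcongr
  have h5 : ‖v‖ * (b.card * (‖v‖⁻¹ * (2 * M))) = 2 * b.card * M := by field_simp
  linarith

/-- The gradient estimate is applied to the positive harmonic function `c - ⟨l, f⟩`. -/
theorem IsConformalHarmonic.abs_inner_le {f : ℂ → E} {Ω : Set E}
    (hf : IsConformalHarmonic f (ball 0 1) Ω) {l : E} {c : ℝ} (hl : ∀ x ∈ Ω, inner ℝ l x < c) :
    |inner ℝ l (dx f 0)| ≤ 6 * (c - inner ℝ l (f 0)) ∧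
      |inner ℝ l (dy f 0)| ≤ 6 * (c - inner ℝ l (f 0)) := by
  have hd : DifferentiableAt ℝ f 0 := hf.differentiableAt (by simp)
  have h := abs_fderiv_le_of_harmonic_pos (u := (fun _ => c) - (innerSL ℝ l) ∘ f)
    (InnerProductSpace.HarmonicOnNhd.sub (InnerProductSpace.harmonicOnNhd_const c)
      (hf.harmonic.comp_CLM _))
    (fun z hz => by simpa using hl _ (hf.mapsTo hz))
  have e : ∀ v, fderiv ℝ ((fun _ => c) - (innerSL ℝ l) ∘ f) 0 v = - inner ℝ l (fderiv ℝ f 0 v) := by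
    intro v
    have := (((innerSL ℝ l).hasFDerivAt.comp 0 hd.hasFDerivAt).const_sub c).fderiv
    have e2 : ((fun _ => c) - (innerSL ℝ l) ∘ f) = fun z => c - ((innerSL ℝ l) ∘ f) z := rfl
    rw [e2, this]; simp
  have h1 := h 1
  have h2 := h Complex.I
  rw [e, abs_neg, Pi.sub_apply, Function.comp_apply, innerSL_apply_apply] at h1 h2
  exact ⟨by simpa [dx] using h1, by simpa [dy] using h2⟩

/-- Converts a bound valid for every admissible disc, `A / K ≤ 1 / r`, into a lower bound for the
infimum. -/
theorem ofReal_le_mul_minimalPseudometric {Ω : Set E} {p v : E} {A K : ℝ} (hK : 0 < K)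
    (h : ∀ r : ℝ, 0 < r → ∀ f : ℂ → E, IsConformalHarmonic f (ball 0 1) Ω → f 0 = p →
      dx f 0 = r • v → r * A ≤ K) :
    ENNReal.ofReal A ≤ ENNReal.ofReal K * minimalPseudometric Ω p v := by
  rw [mul_comm, ← ENNReal.div_le_iff (by simpa using hK) (by simp), ← ENNReal.ofReal_div_of_pos hK]
  refine le_sInf ?_
  rintro _ ⟨r, hr, rfl, f, hf, h0, h1⟩
  refine ENNReal.ofReal_le_ofReal ?_
  have := h r hr f hf h0 h1
  rw [div_le_div_iff₀ hK hr]
  linarith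

/-- The left-hand side is the absolute value of the derivative of `log (c - l)` at `p` along `v`,
ready to be integrated along paths. -/
theorem abs_inner_le_minimalPseudometric {Ω : Set E} {l : E} {c : ℝ}
    (hl : ∀ x ∈ Ω, inner ℝ l x < c) {p v : E} (hp : p ∈ Ω) :
    ENNReal.ofReal (|inner ℝ l v| / (c - inner ℝ l p)) ≤
      ENNReal.ofReal 6 * minimalPseudometric Ω p v := by
  have hpos : 0 < c - inner ℝ l p := sub_pos.2 (hl p hp)
  refine ofReal_le_mul_minimalPseudometric (by norm_num) fun r hr f hf h0 h1 => ?_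
  have := (hf.abs_inner_le hl).1
  rw [h0, h1, inner_smul_right, abs_mul, abs_of_pos hr] at this
  rw [← mul_div_assoc, div_le_iff₀ hpos]
  exact this

end Barrier

/-! ### Integrated lower bounds for the minimal distance. -/

section Paths

variable {E : Type*} [NormedAddCommGroup E] [InnerProductSpace ℝ E]

theorem IsPiecewiseC1Path.exists_finite {Ω : Set E} {p q : E} {γ : ℝ → E}
    (h : IsPiecewiseC1Path Ω p q γ) :
    ContinuousOn γ (Icc 0 1) ∧ ∃ s : Set ℝ, s.Finite ∧
      ∀ x ∈ Icc (0 : ℝ) 1, x ∉ s → DifferentiableAt ℝ γ x := by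
  obtain ⟨k, t, ht, h0, h1, hC⟩ := h.piecewise
  have hcov : ∀ x ∈ Icc (0 : ℝ) 1, ∃ i : Fin k, x ∈ Icc (t i.castSucc) (t i.succ) := by
    intro x hx
    rcases hx.1.eq_or_lt with rfl | hx0
    · have hk : 0 < k := by
        rcases Nat.eq_zero_or_pos k with rfl | hk
        · exact absurd (h0.symm.trans h1) zero_ne_one
        · exact hk
      have e : (⟨0, hk⟩ : Fin k).castSucc = 0 := rfl
      refine ⟨⟨0, hk⟩, ?_, ?_⟩
      · rw [e, h0]
      · rw [← h0]; exact ht.monotone (Fin.zero_le _)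
    · by_contra! hcon
      have : ∀ j : Fin (k + 1), t j < x := by
        intro j
        induction j using Fin.induction with
        | zero => rwa [h0]
        | succ i hi => exact lt_of_not_ge fun h2 => hcon i ⟨hi.le, h2⟩
      exact absurd (this (Fin.last k)) (by rw [h1]; exact not_lt.2 hx.2)
  refine ⟨?_, range t, finite_range t, fun x hx hxt => ?_⟩
  · have : ContinuousOn γ (⋃ i : Fin k, Icc (t i.castSucc) (t i.succ)) :=
      (locallyFinite_of_finite _).continuousOn_iUnion (fun i => isClosed_Icc)
        fun i => (hC i).continuousOn
    exact this.mono fun x hx => mem_iUnion.2 (hcov x hx)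
  · obtain ⟨i, hi⟩ := hcov x hx
    have h1 : t i.castSucc < x := hi.1.lt_of_ne fun h => hxt ⟨_, h⟩
    have h2 : x < t i.succ := hi.2.lt_of_ne fun h => hxt ⟨_, h.symm⟩
    exact ((hC i).contDiffAt (Icc_mem_nhds h1 h2)).differentiableAt one_ne_zero

theorem IsPiecewiseC1Path.enorm_sub_le {Ω : Set E} (hopen : IsOpen Ω) {p q : E} {γ : ℝ → E}
    (h : IsPiecewiseC1Path Ω p q γ) {V : Type*} [NormedAddCommGroup V] [NormedSpace ℝ V]
    [CompleteSpace V] {Φ : E → V} (hΦ : DifferentiableOn ℝ Φ Ω) {s : ℝ} (hs : s ∈ Icc (0 : ℝ) 1) :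
    ‖Φ (γ s) - Φ p‖ₑ ≤ ∫⁻ t in Icc (0 : ℝ) s, ‖fderiv ℝ Φ (γ t) (deriv γ t)‖ₑ := by
  obtain ⟨hc, S, hS, hd⟩ := h.exists_finite
  have hsub : Icc 0 s ⊆ Icc (0 : ℝ) 1 := Icc_subset_Icc_right hs.2
  have hder : ∀ x ∈ Icc 0 s, x ∉ S → HasDerivAt (Φ ∘ γ) (fderiv ℝ Φ (γ x) (deriv γ x)) x := by
    intro x hx hxS
    have := (hΦ.differentiableAt (hopen.mem_nhds (h.mapsTo (hsub hx))))
    exact this.hasFDerivAt.comp_hasDerivAt x (hd x (hsub hx) hxS).hasDerivAt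
  have heq : ∫⁻ t in Icc (0 : ℝ) s, ‖fderiv ℝ Φ (γ t) (deriv γ t)‖ₑ =
      ∫⁻ t in Icc (0 : ℝ) s, ‖deriv (Φ ∘ γ) t‖ₑ := by
    refine lintegral_congr_ae ?_
    rw [EventuallyEq, ae_restrict_iff' measurableSet_Icc]
    filter_upwards [hS.countable.ae_notMem volume] with x hxS hx
    rw [(hder x hx hxS).deriv]
  rw [heq]
  -- An infinite integral makes the bound trivial; a finite one gives the integrability needed for
  -- the fundamental theorem of calculus.
  by_cases hfin : ∫⁻ t in Icc (0 : ℝ) s, ‖deriv (Φ ∘ γ) t‖ₑ = ⊤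
  · rw [hfin]; exact le_top
  have hcont : ContinuousOn (Φ ∘ γ) (Icc 0 s) :=
    hΦ.continuousOn.comp (hc.mono hsub) fun x hx => h.mapsTo (hsub hx)
  have hint : IntegrableOn (deriv (Φ ∘ γ)) (Icc 0 s) := by
    exact ⟨aestronglyMeasurable_deriv _ _, lt_top_iff_ne_top.2 hfin⟩
  have key := MeasureTheory.integral_eq_of_hasDerivAt_off_countable (Φ ∘ γ) (deriv (Φ ∘ γ))
    (a := 0) (b := s) hS.countable (by rwa [uIcc_of_le hs.1])
    (fun x hx => (hder x (by
      have := hx.1; rw [min_eq_left hs.1, max_eq_right hs.1] at this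
      exact Ioo_subset_Icc_self this) hx.2).differentiableAt.hasDerivAt)
    (by rwa [intervalIntegrable_iff_integrableOn_Icc_of_le hs.1])
  rw [Function.comp_apply, Function.comp_apply, h.source] at key
  rw [← key, intervalIntegral.integral_of_le hs.1, ← integral_Icc_eq_integral_Ioc]
  exact enorm_integral_le_lintegral_enorm _

/-- A lower bound for the minimal pseudometric integrates to a lower bound along paths. -/
theorem IsPiecewiseC1Path.enorm_sub_le_mul {Ω : Set E} (hopen : IsOpen Ω) {p q : E} {γ : ℝ → E}
    (h : IsPiecewiseC1Path Ω p q γ) {V : Type*} [NormedAddCommGroup V] [NormedSpace ℝ V]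
    [CompleteSpace V] {Φ : E → V} (hΦ : DifferentiableOn ℝ Φ Ω) {s : ℝ} (hs : s ∈ Icc (0 : ℝ) 1)
    {K : ℝ} (hK : ∀ t ∈ Icc (0 : ℝ) s, ‖fderiv ℝ Φ (γ t) (deriv γ t)‖ₑ ≤
      ENNReal.ofReal K * minimalPseudometric Ω (γ t) (deriv γ t)) :
    ‖Φ (γ s) - Φ p‖ₑ ≤ ENNReal.ofReal K *
      ∫⁻ t in Icc (0 : ℝ) 1, minimalPseudometric Ω (γ t) (deriv γ t) := by
  calc _ ≤ ∫⁻ t in Icc (0 : ℝ) s, ‖fderiv ℝ Φ (γ t) (deriv γ t)‖ₑ := h.enorm_sub_le hopen hΦ hs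
    _ ≤ ∫⁻ t in Icc (0 : ℝ) s, ENNReal.ofReal K * minimalPseudometric Ω (γ t) (deriv γ t) :=
      setLIntegral_mono' measurableSet_Icc hK
    _ = ENNReal.ofReal K * ∫⁻ t in Icc (0 : ℝ) s, minimalPseudometric Ω (γ t) (deriv γ t) :=
      lintegral_const_mul' _ _ ENNReal.ofReal_ne_top
    _ ≤ _ := by gcongr; exact hs.2

/-- The bound holds at every time `s`, not only at the endpoint: a short path must be kept, along
its whole length, in the region where `c - l` is controlled. -/
theorem IsPiecewiseC1Path.log_sub_le {Ω : Set E} (hopen : IsOpen Ω) {p q : E} {γ : ℝ → E}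
    (h : IsPiecewiseC1Path Ω p q γ) {l : E} {c : ℝ} (hl : ∀ x ∈ Ω, inner ℝ l x < c) {s : ℝ}
    (hs : s ∈ Icc (0 : ℝ) 1) :
    ‖Real.log (c - inner ℝ l (γ s)) - Real.log (c - inner ℝ l p)‖ₑ ≤ ENNReal.ofReal 6 *
      ∫⁻ t in Icc (0 : ℝ) 1, minimalPseudometric Ω (γ t) (deriv γ t) := by
  have hder : ∀ x ∈ Ω, HasFDerivAt (fun x => Real.log (c - inner ℝ l x))
      ((c - inner ℝ l x)⁻¹ • -innerSL ℝ l) x := fun x hx =>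
    (((innerSL ℝ l).hasFDerivAt (x := x)).const_sub c).log (sub_pos.2 (hl x hx)).ne'
  refine h.enorm_sub_le_mul hopen (Φ := fun x => Real.log (c - inner ℝ l x))
    (fun x hx => (hder x hx).differentiableAt.differentiableWithinAt) hs fun t ht => ?_
  have hx := h.mapsTo (Icc_subset_Icc_right hs.2 ht)
  refine le_trans (le_of_eq ?_) (abs_inner_le_minimalPseudometric hl hx)
  have hpos : 0 < c - inner ℝ l (γ t) := sub_pos.2 (hl _ hx)
  rw [(hder _ hx).fderiv, ← ofReal_norm]
  simp [abs_of_pos hpos, div_eq_inv_mul]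

theorem le_mul_exp_of_enorm_log_sub_le {a b : ℝ} (ha : 0 < a) (hb : 0 < b) {L : ℝ≥0∞} (hL : L ≤ 1)
    (h : ‖Real.log a - Real.log b‖ₑ ≤ ENNReal.ofReal 6 * L) :
    a ≤ b * Real.exp 6 ∧ b ≤ a * Real.exp 6 := by
  have h1 : ‖Real.log a - Real.log b‖ₑ ≤ ENNReal.ofReal 6 := h.trans (mul_le_of_le_one_right' hL)
  rw [← ofReal_norm, ENNReal.ofReal_le_ofReal_iff (by norm_num), Real.norm_eq_abs,
    abs_le] at h1
  constructor
  · rw [← Real.log_le_log_iff ha (by positivity), Real.log_mul hb.ne' (Real.exp_pos _).ne',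
      Real.log_exp]
    linarith
  · rw [← Real.log_le_log_iff hb (by positivity), Real.log_mul ha.ne' (Real.exp_pos _).ne',
      Real.log_exp]
    linarith

theorem exists_path_of_minimalDist_lt {Ω : Set E} {p q : E} {L : ℝ≥0∞}
    (h : minimalDist Ω p q < L) : ∃ γ, IsPiecewiseC1Path Ω p q γ ∧
      ∫⁻ t in Icc (0 : ℝ) 1, minimalPseudometric Ω (γ t) (deriv γ t) < L := by
  simpa only [minimalDist, iInf_lt_iff, exists_prop] using h

/-- A Harnack inequality for the minimal distance. The first bound confines Cauchy sequences to a
region where `c - l` is bounded; the second, for a supporting functional, keeps them away from its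
hyperplane. -/
theorem le_mul_exp_of_minimalDist_lt_one {Ω : Set E} (hopen : IsOpen Ω) {l : E} {c : ℝ}
    (hl : ∀ x ∈ Ω, inner ℝ l x < c) {p q : E} (hp : p ∈ Ω) (hq : q ∈ Ω)
    (h : minimalDist Ω p q < 1) :
    c - inner ℝ l q ≤ (c - inner ℝ l p) * Real.exp 6 ∧
      c - inner ℝ l p ≤ (c - inner ℝ l q) * Real.exp 6 := by
  obtain ⟨γ, hγ, hL⟩ := exists_path_of_minimalDist_lt h
  have := hγ.log_sub_le hopen hl (right_mem_Icc.2 zero_le_one)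
  rw [hγ.target] at this
  exact le_mul_exp_of_enorm_log_sub_le (sub_pos.2 (hl q hq)) (sub_pos.2 (hl p hp)) hL.le this

/-- On sets where finitely many bounding functionals without a common plane in their kernel are
bounded below, the minimal distance dominates the Euclidean one. -/
theorem exists_enorm_sub_le_minimalDist [FiniteDimensional ℝ E] {Ω : Set E} (hopen : IsOpen Ω)
    (b : Finset E) (c : E → ℝ) (hc : ∀ l ∈ b, ∀ x ∈ Ω, inner ℝ l x < c l)
    (hb : ∀ v w : E, (∀ l ∈ b, inner ℝ l v = 0) → (∀ l ∈ b, inner ℝ l w = 0) →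
      ¬ LinearIndependent ℝ ![v, w]) (M : ℝ) :
    ∃ K : ℝ, 0 < K ∧ ∀ p ∈ Ω, (∀ l ∈ b, c l - inner ℝ l p ≤ M) → ∀ q,
      minimalDist Ω p q < 1 → ‖q - p‖ₑ ≤ ENNReal.ofReal K * minimalDist Ω p q := by
  obtain ⟨C, hC, hCb⟩ := exists_norm_le_of_conformal b hb
  -- The gradient estimate, with `c - l` enlarged by the Harnack factor `e⁶` along a path of length
  -- below `1`; the `+ 1` ensures positivity when `M = 0`.
  set N := 6 * (|M| * Real.exp 6) + 1
  have hN : 0 < N := by positivity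
  have metric : ∀ p ∈ Ω, (∀ l ∈ b, c l - inner ℝ l p ≤ |M| * Real.exp 6) → ∀ v,
      ‖v‖ₑ ≤ ENNReal.ofReal (C * N) * minimalPseudometric Ω p v := by
    intro p hp hpM v
    rw [← ofReal_norm]
    refine ofReal_le_mul_minimalPseudometric (by positivity) fun r hr f hf h0 h1 => ?_
    have := hCb (dx f 0) (dy f 0) N (hf.norm_eq 0 (by simp)) (hf.inner_eq_zero 0 (by simp))
      (fun l hl => ((hf.abs_inner_le (hc l hl)).1.trans
        (by rw [h0]; linarith [hpM l hl])))
      (fun l hl => ((hf.abs_inner_le (hc l hl)).2.trans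
        (by rw [h0]; linarith [hpM l hl]))) hN.le
    rwa [h1, norm_smul, Real.norm_of_nonneg hr.le] at this
  refine ⟨C * N, by positivity, fun p hp hpM q hpq => ?_⟩
  have hK0 : ENNReal.ofReal (C * N) ≠ 0 := by
    rw [Ne, ENNReal.ofReal_eq_zero, not_le]; positivity
  rw [mul_comm, ← ENNReal.div_le_iff hK0 ENNReal.ofReal_ne_top]
  refine le_of_forall_gt fun L hL => ?_
  -- The path is shorter than `1` as well as `L`, so it never leaves the region where `metric`
  -- applies.
  obtain ⟨γ, hγ, hγL⟩ := exists_path_of_minimalDist_lt (lt_min hL hpq)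
  have hγ1 := hγL.le.trans (min_le_right _ _)
  refine lt_of_le_of_lt ?_ (hγL.trans_le (min_le_left _ _))
  rw [ENNReal.div_le_iff hK0 ENNReal.ofReal_ne_top, mul_comm]
  have := hγ.enorm_sub_le_mul hopen (Φ := id) (K := C * N) differentiableOn_id
    (right_mem_Icc.2 zero_le_one) fun t ht => ?_
  · simpa [hγ.target] using this
  · rw [fderiv_id, ContinuousLinearMap.id_apply]
    refine metric _ (hγ.mapsTo ht) (fun l hl => ?_) _
    have hpos := sub_pos.2 (hc l hl _ (hγ.mapsTo ht))
    refine (le_mul_exp_of_enorm_log_sub_le hpos (sub_pos.2 (hc l hl p hp)) hγ1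
      (hγ.log_sub_le hopen (hc l hl) ht)).1.trans ?_
    have := (hpM l hl).trans (le_abs_self M)
    gcongr

end Paths

/-- From some index on, a Cauchy sequence lies within distance `1` of a fixed term, where the
minimal distance dominates the Euclidean one. It thus has a Euclidean limit; once this is known to
lie in `Ω`, the local upper bound `minimalDist_le` gives convergence in the minimal distance. -/
theorem isCompleteHyperbolic_of_not_containsAffinePlane {E : Type*} [NormedAddCommGroup E]
    [InnerProductSpace ℝ E] [FiniteDimensional ℝ E] (hE : 2 ≤ Module.finrank ℝ E) {Ω : Set E}
    (hopen : IsOpen Ω) (hconvex : Convex ℝ Ω) (hP : ¬ ContainsAffinePlane Ω) :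
    IsCompleteHyperbolic Ω := by
  rcases Ω.eq_empty_or_nonempty with rfl | hne
  · exact ⟨fun p hp => hp.elim, fun u hu => (hu 0).elim⟩
  obtain ⟨b, hbar, hbo⟩ := exists_finite_barrier Ω
  have hb : ∀ v w : E, (∀ l ∈ b, inner ℝ l v = 0) → (∀ l ∈ b, inner ℝ l w = 0) →
      ¬ LinearIndependent ℝ ![v, w] := fun v w hv hw =>
    linearIndependent_orthogonal_barrier hopen hconvex hne hP (hbo v hv) (hbo w hw)
  have hbar' : ∀ l ∈ b, ∃ c : ℝ, ∀ x ∈ Ω, inner ℝ l x < c := fun l hl => hbar hl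
  choose! c hc' using hbar'
  have hbd : ∀ p : E, ∃ M : ℝ, ∀ l ∈ b, c l - inner ℝ l p ≤ M := fun p => by
    obtain ⟨M, hM⟩ := (b.image fun l => c l - inner ℝ l p).bddAbove
    exact ⟨M, fun l hl => hM (Finset.mem_coe.2 (Finset.mem_image_of_mem _ hl))⟩
  refine ⟨fun p hp q hq hpq => ?_, fun u hu hcau => ?_⟩
  · obtain ⟨M, hM⟩ := hbd p
    obtain ⟨K, hK, hle⟩ := exists_enorm_sub_le_minimalDist hopen b c hc' hb M
    have := hle p hp hM q (by rw [hpq]; exact one_pos)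
    rw [hpq, mul_zero, nonpos_iff_eq_zero, enorm_eq_zero, sub_eq_zero] at this
    exact this.symm
  · obtain ⟨N, hN⟩ := hcau 1 one_pos
    obtain ⟨M, hM⟩ := hbd (u N)
    have hM' : ∀ k ≥ N, ∀ l ∈ b, c l - inner ℝ l (u k) ≤ M * Real.exp 6 := fun k hk l hl =>
      (le_mul_exp_of_minimalDist_lt_one hopen (hc' l hl) (hu N) (hu k) (hN N le_rfl k hk)).1.trans
        (by have := hM l hl; gcongr)
    obtain ⟨K, hK, hle⟩ := exists_enorm_sub_le_minimalDist hopen b c hc' hb (M * Real.exp 6)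
    have hK0 : ENNReal.ofReal K ≠ 0 := by
      rw [Ne, ENNReal.ofReal_eq_zero, not_le]; exact hK
    have hcs : CauchySeq u := by
      refine EMetric.cauchySeq_iff.2 fun ε hε => ?_
      obtain ⟨N', hN'⟩ := hcau (min 1 (ε / ENNReal.ofReal K))
        (lt_min one_pos (ENNReal.div_pos hε.ne' ENNReal.ofReal_ne_top))
      refine ⟨max N N', fun m hm k hk => ?_⟩
      have h1 := hN' k (le_of_max_le_right hk) m (le_of_max_le_right hm)
      have h2 := hle (u k) (hu k) (hM' k (le_of_max_le_left hk)) (u m)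
        (h1.trans_le (min_le_left _ _))
      rw [edist_eq_enorm_sub]
      refine h2.trans_lt ?_
      have h3 := h1.trans_le (min_le_right _ _)
      rw [mul_comm]
      exact (ENNReal.lt_div_iff_mul_lt (Or.inl hK0) (Or.inl ENNReal.ofReal_ne_top)).1 h3
    obtain ⟨p, hp⟩ := cauchySeq_tendsto_of_complete hcs
    -- Otherwise `l` separates `p` from `Ω`, and `l(p) - l(u k)` tends to `0` while the Harnack
    -- bound keeps it above `e⁻⁶ (l(p) - l(u N)) > 0`.
    have hpΩ : p ∈ Ω := by
      by_contra hpΩ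
      obtain ⟨l, hl⟩ := exists_support hopen hconvex hpΩ
      have hlim : Tendsto (fun k => (inner ℝ l p - inner ℝ l (u k)) * Real.exp 6) atTop
          (𝓝 ((inner ℝ l p - inner ℝ l p) * Real.exp 6)) :=
        ((tendsto_const_nhds.inner hp).const_sub _).mul_const _
      have := ge_of_tendsto hlim (b := inner ℝ l p - inner ℝ l (u N)) (by
        filter_upwards [eventually_ge_atTop N] with k hk
        exact (le_mul_exp_of_minimalDist_lt_one hopen hl (hu N) (hu k) (hN N le_rfl k hk)).2)
      rw [sub_self, zero_mul] at this
      linarith [hl _ (hu N)]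
    obtain ⟨r, hr, hball⟩ := Metric.isOpen_iff.1 hopen p hpΩ
    refine ⟨p, hpΩ, ?_⟩
    have hdist : Tendsto (fun k => ENNReal.ofReal (2 * dist (u k) p / (r / 2))) atTop (𝓝 0) := by
      have : Tendsto (fun k => 2 * dist (u k) p / (r / 2)) atTop (𝓝 (2 * 0 / (r / 2))) :=
        ((tendsto_iff_dist_tendsto_zero.1 hp).const_mul 2).div_const _
      simpa using ENNReal.tendsto_ofReal this
    refine tendsto_of_tendsto_of_tendsto_of_le_of_le' tendsto_const_nhds hdist
      (Eventually.of_forall fun _ => zero_le) ?_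
    filter_upwards [hp.eventually (ball_mem_nhds p (half_pos hr))] with k hk
    exact minimalDist_le hE (half_pos hr) (by rwa [mul_div_cancel₀ _ two_ne_zero]) hk

/-! ### The second derivative test and calculus of partial derivatives. -/

section SecondDerivative

/-- At an interior maximum the Hessian is negative semidefinite. -/
theorem hessian_nonpos_of_isLocalMax {v : ℂ → ℝ} {z : ℂ} (hv : ContDiffAt ℝ 2 v z)
    (hmax : IsLocalMax v z) (d : ℂ) : fderiv ℝ (fun w => fderiv ℝ v w d) z d ≤ 0 := by
  set l : ℝ → ℂ := fun t => z + t * d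
  have hl : ∀ t, HasDerivAt l d t := fun t => by
    have := ((Complex.ofRealCLM.hasDerivAt (x := t)).mul_const d).const_add z
    rwa [Complex.ofRealCLM_apply, Complex.ofReal_one, one_mul] at this
  have hl0 : l 0 = z := by simp [l]
  have hlc : Tendsto l (𝓝 0) (𝓝 z) := by
    have := (hl 0).continuousAt.tendsto
    rwa [hl0] at this
  have hd1 : ∀ᶠ w in 𝓝 z, DifferentiableAt ℝ v w :=
    (hv.eventually (by simp)).mono fun w hw => hw.differentiableAt two_ne_zero
  have hder : ∀ᶠ t in 𝓝 (0 : ℝ), HasDerivAt (v ∘ l) (fderiv ℝ v (l t) d) t :=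
    (hlc.eventually hd1).mono fun t ht => ht.hasFDerivAt.comp_hasDerivAt t (hl t)
  have hd2 : DifferentiableAt ℝ (fun w => fderiv ℝ v w d) z :=
    ((hv.fderiv_right (m := 1) (by norm_num)).clm_apply contDiffAt_const).differentiableAt
      one_ne_zero
  have hdd : deriv (deriv (v ∘ l)) 0 = fderiv ℝ (fun w => fderiv ℝ v w d) z d := by
    have : deriv (v ∘ l) =ᶠ[𝓝 0] (fun w => fderiv ℝ v w d) ∘ l := hder.mono fun t ht => ht.deriv
    rw [this.deriv_eq]
    have h2 : HasFDerivAt (fun w => fderiv ℝ v w d)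
        (fderiv ℝ (fun w => fderiv ℝ v w d) z) (l 0) := by rw [hl0]; exact hd2.hasFDerivAt
    exact (h2.comp_hasDerivAt (0 : ℝ) (hl 0)).deriv
  have hlm : IsLocalMax (v ∘ l) 0 := by
    have := hlc.eventually hmax
    refine this.mono fun t ht => ?_
    simpa [hl0] using ht
  by_contra! hpos
  rw [← hdd] at hpos
  -- A positive second derivative would make `0` a local minimum as well as a local maximum, so the
  -- function would be locally constant.
  have hmin : IsLocalMin (v ∘ l) 0 :=
    isLocalMin_of_deriv_deriv_pos hpos hlm.deriv_eq_zero hder.self_of_nhds.continuousAt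
  have hconst : v ∘ l =ᶠ[𝓝 0] fun _ => (v ∘ l) 0 := by
    filter_upwards [hmin, hlm] with t h1 h2 using le_antisymm h2 h1
  have : deriv (v ∘ l) =ᶠ[𝓝 0] fun _ => 0 := by
    filter_upwards [hconst.eventuallyEq_nhds] with t ht
    rw [ht.deriv_eq, deriv_const]
  rw [this.deriv_eq, deriv_const] at hpos
  exact lt_irrefl _ hpos

end SecondDerivative

section Partial

variable {V : Type*} [NormedAddCommGroup V] [NormedSpace ℝ V] {u : ℂ → V} {z : ℂ}

theorem contDiffAt_dx {k m : WithTop ℕ∞} (hu : ContDiffAt ℝ k u z) (h : m + 1 ≤ k) :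
    ContDiffAt ℝ m (dx u) z :=
  (hu.fderiv_right h).clm_apply contDiffAt_const

theorem contDiffAt_dy {k m : WithTop ℕ∞} (hu : ContDiffAt ℝ k u z) (h : m + 1 ≤ k) :
    ContDiffAt ℝ m (dy u) z :=
  (hu.fderiv_right h).clm_apply contDiffAt_const

theorem dx_dy_comm (hu : ContDiffAt ℝ 2 u z) : dy (dx u) z = dx (dy u) z := by
  have hd : DifferentiableAt ℝ (fderiv ℝ u) z :=
    (hu.fderiv_right (m := 1) (by norm_num)).differentiableAt one_ne_zero
  have h1 : dy (dx u) z = fderiv ℝ (fderiv ℝ u) z Complex.I 1 := by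
    change fderiv ℝ (fun w => fderiv ℝ u w 1) z Complex.I = _
    rw [fderiv_clm_apply hd (differentiableAt_const (1 : ℂ))]; simp
  have h2 : dx (dy u) z = fderiv ℝ (fderiv ℝ u) z 1 Complex.I := by
    change fderiv ℝ (fun w => fderiv ℝ u w Complex.I) z 1 = _
    rw [fderiv_clm_apply hd (differentiableAt_const Complex.I)]; simp
  rw [h1, h2]
  exact (hu.isSymmSndFDerivAt (by simp)) _ _

end Partial

/-! ### The Laplace-Beltrami operator and harmonicity of coordinate functions. -/

section LaplaceBeltrami

variable {E : Type*} [NormedAddCommGroup E] [InnerProductSpace ℝ E] {X : ℂ → E} {z : ℂ}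

theorem fderiv_inner_eq {f g : ℂ → E} (hf : DifferentiableAt ℝ f z) (hg : DifferentiableAt ℝ g z)
    (d : ℂ) : fderiv ℝ (fun w => inner ℝ (f w) (g w)) z d =
      inner ℝ (f z) (fderiv ℝ g z d) + inner ℝ (fderiv ℝ f z d) (g z) :=
  fderiv_inner_apply ℝ hf hg d

theorem metric_det_pos (hinj : Function.Injective (fderiv ℝ X z)) :
    0 < metricE X z ∧ 0 < metricG X z ∧
      0 < metricE X z * metricG X z - metricF X z ^ 2 := by
  have hne : ∀ d : ℂ, d ≠ 0 → fderiv ℝ X z d ≠ 0 := fun d hd h =>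
    hd (hinj (h.trans (map_zero _).symm))
  have hE : 0 < metricE X z := real_inner_self_pos.2 (hne 1 one_ne_zero)
  have hG : 0 < metricG X z := real_inner_self_pos.2 (hne _ Complex.I_ne_zero)
  refine ⟨hE, hG, ?_⟩
  -- The squared length of `G X_x - F X_y` is `G (EG - F²)`.
  have h := real_inner_self_pos.2 (hne (metricG X z - metricF X z * Complex.I) fun h => by
    have := congrArg Complex.re h
    simp at this
    exact hG.ne' this)
  rw [fderiv_apply_eq] at h
  simp only [inner_add_left, inner_add_right, real_inner_smul_left, real_inner_smul_right] at h
  simp at h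
  have e1 : inner ℝ (dx X z) (dx X z) = metricE X z := rfl
  have e2 : inner ℝ (dx X z) (dy X z) = metricF X z := rfl
  have e3 : inner ℝ (dy X z) (dy X z) = metricG X z := rfl
  have e4 : inner ℝ (dy X z) (dx X z) = metricF X z := real_inner_comm _ _
  simp only [e1, e2, e3, e4, ← real_inner_self_eq_norm_sq] at h
  have h' : 0 < metricG X z * (metricE X z * metricG X z - metricF X z ^ 2) := by
    nlinarith [h]
  exact (mul_pos_iff_of_pos_left hG).1 h'

/-- `W Δ`, written as a second order operator without zeroth order term. -/
noncomputable def beltramiOperator (X : ℂ → E) {V : Type*} [NormedAddCommGroup V] [NormedSpace ℝ V] (u : ℂ → V)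
    (z : ℂ) : V :=
  (metricG X z / areaDensity X z) • dx (dx u) z - (metricF X z / areaDensity X z) • dx (dy u) z -
      (metricF X z / areaDensity X z) • dy (dx u) z +
      (metricE X z / areaDensity X z) • dy (dy u) z +
    (dx (fun w => metricG X w / areaDensity X w) z -
      dy (fun w => metricF X w / areaDensity X w) z) • dx u z +
    (dy (fun w => metricE X w / areaDensity X w) z -
      dx (fun w => metricF X w / areaDensity X w) z) • dy u z

theorem contDiffAt_metric (hX : ContDiffAt ℝ 2 X z) :
    ContDiffAt ℝ 1 (metricE X) z ∧ ContDiffAt ℝ 1 (metricF X) z ∧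
      ContDiffAt ℝ 1 (metricG X) z := by
  have h1 : ContDiffAt ℝ 1 (dx X) z := contDiffAt_dx hX (by norm_num)
  have h2 : ContDiffAt ℝ 1 (dy X) z := contDiffAt_dy hX (by norm_num)
  exact ⟨h1.inner ℝ h1, h1.inner ℝ h2, h2.inner ℝ h2⟩

theorem areaDensity_pos (hinj : Function.Injective (fderiv ℝ X z)) : 0 < areaDensity X z :=
  Real.sqrt_pos.2 (metric_det_pos hinj).2.2

theorem differentiableAt_areaDensity (hX : ContDiffAt ℝ 2 X z)
    (hinj : Function.Injective (fderiv ℝ X z)) : DifferentiableAt ℝ (areaDensity X) z := by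
  obtain ⟨hE, hF, hG⟩ := contDiffAt_metric hX
  exact (((hE.mul hG).sub (hF.pow 2)).differentiableAt one_ne_zero).sqrt
    (metric_det_pos hinj).2.2.ne'

theorem eventually_areaDensity_pos (hX : ContDiffAt ℝ 2 X z)
    (hinj : Function.Injective (fderiv ℝ X z)) : ∀ᶠ w in 𝓝 z, 0 < areaDensity X w :=
  (differentiableAt_areaDensity hX hinj).continuousAt.eventually
    (lt_mem_nhds (areaDensity_pos hinj))

theorem areaDensity_sq (h : 0 < areaDensity X z) :
    areaDensity X z ^ 2 = metricE X z * metricG X z - metricF X z ^ 2 :=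
  Real.sq_sqrt (Real.sqrt_pos.1 h).le

theorem fderiv_mul_sub_mul {f g h k : ℂ → ℝ} (hf : DifferentiableAt ℝ f z)
    (hg : DifferentiableAt ℝ g z) (hh : DifferentiableAt ℝ h z) (hk : DifferentiableAt ℝ k z)
    (d : ℂ) : fderiv ℝ (fun w => f w * g w - h w * k w) z d =
      fderiv ℝ f z d * g z + f z * fderiv ℝ g z d -
        fderiv ℝ h z d * k z - h z * fderiv ℝ k z d := by
  have := ((hf.hasFDerivAt.mul hg.hasFDerivAt).sub (hh.hasFDerivAt.mul hk.hasFDerivAt)).fderiv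
  change fderiv ℝ (f * g - h * k) z d = _
  rw [this]
  simp
  ring

/-- The derivatives of the identities between the coefficients of the Laplace-Beltrami operator. -/
theorem fderiv_coefficients (hX : ContDiffAt ℝ 2 X z) (hinj : Function.Injective (fderiv ℝ X z))
    (d : ℂ) {a b c : ℂ → ℝ} (ha : a = fun w => metricG X w / areaDensity X w)
    (hb : b = fun w => metricF X w / areaDensity X w)
    (hc : c = fun w => metricE X w / areaDensity X w) :
    fderiv ℝ a z d * metricE X z + a z * fderiv ℝ (metricE X) z d -
        fderiv ℝ b z d * metricF X z - b z * fderiv ℝ (metricF X) z d =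
        fderiv ℝ (areaDensity X) z d ∧
      fderiv ℝ c z d * metricG X z + c z * fderiv ℝ (metricG X) z d -
        fderiv ℝ b z d * metricF X z - b z * fderiv ℝ (metricF X) z d =
        fderiv ℝ (areaDensity X) z d ∧
      fderiv ℝ a z d * metricF X z + a z * fderiv ℝ (metricF X) z d -
        fderiv ℝ b z d * metricG X z - b z * fderiv ℝ (metricG X) z d = 0 ∧
      fderiv ℝ c z d * metricF X z + c z * fderiv ℝ (metricF X) z d -
        fderiv ℝ b z d * metricE X z - b z * fderiv ℝ (metricE X) z d = 0 ∧
      2 * areaDensity X z * fderiv ℝ (areaDensity X) z d =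
        fderiv ℝ (metricE X) z d * metricG X z + metricE X z * fderiv ℝ (metricG X) z d -
          2 * metricF X z * fderiv ℝ (metricF X) z d := by
  obtain ⟨hE, hF, hG⟩ := contDiffAt_metric hX
  have hE := hE.differentiableAt one_ne_zero
  have hF := hF.differentiableAt one_ne_zero
  have hG := hG.differentiableAt one_ne_zero
  have hW := differentiableAt_areaDensity hX hinj
  have hW0 := (areaDensity_pos hinj).ne'
  have hda : DifferentiableAt ℝ a z := by
    simp only [ha, div_eq_mul_inv]; exact hG.mul (hW.inv hW0)
  have hdb : DifferentiableAt ℝ b z := by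
    simp only [hb, div_eq_mul_inv]; exact hF.mul (hW.inv hW0)
  have hdc : DifferentiableAt ℝ c z := by
    simp only [hc, div_eq_mul_inv]; exact hE.mul (hW.inv hW0)
  have comb := fun f g h k hf hg hh hk =>
    fderiv_mul_sub_mul (z := z) (f := f) (g := g) (h := h) (k := k) hf hg hh hk d
  have hev := eventually_areaDensity_pos hX hinj
  -- The identities being differentiated are `aE - bF = W`, `cG - bF = W`, `aF - bG = 0`, `cF - bE =
  -- 0` and `W² = EG - F²`.
  refine ⟨?_, ?_, ?_, ?_, ?_⟩
  · rw [← comb a _ b _ hda hE hdb hF]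
    refine DFunLike.congr_fun (EventuallyEq.fderiv_eq (hev.mono fun w hw => ?_)) d
    have := areaDensity_sq hw
    simp only [ha, hb]
    field_simp
    linear_combination -this
  · rw [← comb c _ b _ hdc hG hdb hF]
    refine DFunLike.congr_fun (EventuallyEq.fderiv_eq (hev.mono fun w hw => ?_)) d
    have := areaDensity_sq hw
    simp only [hc, hb]
    field_simp
    linear_combination -this
  · rw [← comb a _ b _ hda hF hdb hG]
    have : (fun w => a w * metricF X w - b w * metricG X w) = fun _ => 0 := by
      ext w; simp only [ha, hb]; ring
    rw [this]; simp
  · rw [← comb c _ b _ hdc hF hdb hE]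
    have : (fun w => c w * metricF X w - b w * metricE X w) = fun _ => 0 := by
      ext w; simp only [hc, hb]; ring
    rw [this]; simp
  · have h1 := comb _ _ _ _ hE hG hF hF
    have h2 := comb _ _ _ _ hW hW (differentiableAt_const (0 : ℝ)) (differentiableAt_const (0 : ℝ))
    have : (fun w => areaDensity X w * areaDensity X w - 0 * 0) =ᶠ[𝓝 z]
        fun w => metricE X w * metricG X w - metricF X w * metricF X w :=
      hev.mono fun w hw => by
        have := areaDensity_sq hw
        linear_combination this
    rw [this.fderiv_eq] at h2
    linear_combination h1 - h2

/-- The coordinate functions of a minimal surface are harmonic. -/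
theorem beltramiOperator_self (hX : ContDiffAt ℝ 2 X z)
    (hinj : Function.Injective (fderiv ℝ X z)) (hmin : MeanCurvatureVanishes X z) :
    beltramiOperator X X z = 0 := by
  have hx : DifferentiableAt ℝ (dx X) z :=
    (contDiffAt_dx (m := 1) hX (by norm_num)).differentiableAt one_ne_zero
  have hy : DifferentiableAt ℝ (dy X) z :=
    (contDiffAt_dy (m := 1) hX (by norm_num)).differentiableAt one_ne_zero
  have hcomm := dx_dy_comm hX
  have hW := areaDensity_pos hinj
  set W := areaDensity X z with hWdef
  set S := Submodule.span ℝ {dx X z, dy X z} with hS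
  have hxS : dx X z ∈ S := Submodule.subset_span (by simp)
  have hyS : dy X z ∈ S := Submodule.subset_span (by simp)
  -- The second-order part is `W⁻¹` times the vector that is tangential by minimality, and the
  -- first-order part is tangential anyway.
  have hmem : beltramiOperator X X z ∈ S := by
    unfold beltramiOperator
    refine S.add_mem (S.add_mem ?_ (S.smul_mem _ hxS)) (S.smul_mem _ hyS)
    have := S.smul_mem W⁻¹ hmin
    rw [hcomm, ← hWdef]
    convert this using 1
    module
  have dE : ∀ d, fderiv ℝ (metricE X) z d = 2 * inner ℝ (fderiv ℝ (dx X) z d) (dx X z) :=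
    fun d => (fderiv_inner_eq hx hx d).trans (by rw [real_inner_comm]; ring)
  have dF : ∀ d, fderiv ℝ (metricF X) z d =
      inner ℝ (fderiv ℝ (dy X) z d) (dx X z) + inner ℝ (fderiv ℝ (dx X) z d) (dy X z) :=
    fun d => (fderiv_inner_eq hx hy d).trans (by rw [real_inner_comm])
  have dG : ∀ d, fderiv ℝ (metricG X) z d = 2 * inner ℝ (fderiv ℝ (dy X) z d) (dy X z) :=
    fun d => (fderiv_inner_eq hy hy d).trans (by rw [real_inner_comm]; ring)
  obtain ⟨x1, x2, x3, x4, x5⟩ := fderiv_coefficients hX hinj 1 rfl rfl rfl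
  obtain ⟨y1, y2, y3, y4, y5⟩ := fderiv_coefficients hX hinj Complex.I rfl rfl rfl
  simp only [dE, dF, dG] at x1 x2 x3 x4 x5 y1 y2 y3 y4 y5
  have e1 : inner ℝ (dx X z) (dx X z) = metricE X z := rfl
  have e2 : inner ℝ (dx X z) (dy X z) = metricF X z := rfl
  have e3 : inner ℝ (dy X z) (dy X z) = metricG X z := rfl
  have e4 : inner ℝ (dy X z) (dx X z) = metricF X z := real_inner_comm _ _
  have f1 : fderiv ℝ (dx X) z 1 = dx (dx X) z := rfl
  have f2 : fderiv ℝ (dx X) z Complex.I = dx (dy X) z := hcomm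
  have f3 : fderiv ℝ (dy X) z 1 = dx (dy X) z := rfl
  have f4 : fderiv ℝ (dy X) z Complex.I = dy (dy X) z := rfl
  simp only [f1, f2, f3, f4] at x1 x2 x3 x4 x5 y1 y2 y3 y4 y5
  have x6 := (eq_div_iff (by positivity : 2 * W ≠ 0)).2 ((mul_comm _ _).trans x5)
  have y6 := (eq_div_iff (by positivity : 2 * W ≠ 0)).2 ((mul_comm _ _).trans y5)
  have g1 : ∀ u : ℂ → ℝ, dx u z = fderiv ℝ u z 1 := fun _ => rfl
  have g2 : ∀ u : ℂ → ℝ, dy u z = fderiv ℝ u z Complex.I := fun _ => rfl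
  -- Orthogonality to the tangent plane does not use minimality: it follows from the differentiated
  -- identities. Being tangential and normal, the vector is zero.
  have hox : inner ℝ (beltramiOperator X X z) (dx X z) = 0 := by
    unfold beltramiOperator
    rw [hcomm, ← hWdef]
    simp only [inner_add_left, inner_sub_left, real_inner_smul_left, e1, e4, g1, g2]
    linear_combination x1 + y4 + x6
  have hoy : inner ℝ (beltramiOperator X X z) (dy X z) = 0 := by
    unfold beltramiOperator
    rw [hcomm, ← hWdef]
    simp only [inner_add_left, inner_sub_left, real_inner_smul_left, e2, e3, g1, g2]
    linear_combination y2 + x3 + y6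
  have : ∀ v ∈ S, inner ℝ (beltramiOperator X X z) v = 0 := fun v hv => by
    obtain ⟨s, t, rfl⟩ := Submodule.mem_span_pair.1 hv
    rw [inner_add_right, inner_smul_right, inner_smul_right, hox, hoy, mul_zero, mul_zero, add_zero]
  exact inner_self_eq_zero.1 (this _ hmem)

end LaplaceBeltrami

/-! ### Comparison of linear functions on a minimal surface with harmonic functions. -/

section Comparison

variable {E : Type*} [NormedAddCommGroup E] [InnerProductSpace ℝ E] {X : ℂ → E} {z : ℂ}

theorem laplaceBeltrami_eq (hX : ContDiffAt ℝ 2 X z) (hinj : Function.Injective (fderiv ℝ X z))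
    {u : ℂ → ℝ} (hu : ContDiffAt ℝ 2 u z) :
    laplaceBeltrami X u z = (areaDensity X z)⁻¹ * beltramiOperator X u z := by
  obtain ⟨hE, hF, hG⟩ := contDiffAt_metric hX
  have hW := differentiableAt_areaDensity hX hinj
  have hW0 := (areaDensity_pos hinj).ne'
  have hda : DifferentiableAt ℝ (fun w => metricG X w / areaDensity X w) z := by
    simp only [div_eq_mul_inv]; exact (hG.differentiableAt one_ne_zero).mul (hW.inv hW0)
  have hdb : DifferentiableAt ℝ (fun w => metricF X w / areaDensity X w) z := by
    simp only [div_eq_mul_inv]; exact (hF.differentiableAt one_ne_zero).mul (hW.inv hW0)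
  have hdc : DifferentiableAt ℝ (fun w => metricE X w / areaDensity X w) z := by
    simp only [div_eq_mul_inv]; exact (hE.differentiableAt one_ne_zero).mul (hW.inv hW0)
  have hx : DifferentiableAt ℝ (dx u) z :=
    (contDiffAt_dx (m := 1) hu (by norm_num)).differentiableAt one_ne_zero
  have hy : DifferentiableAt ℝ (dy u) z :=
    (contDiffAt_dy (m := 1) hu (by norm_num)).differentiableAt one_ne_zero
  have e1 : (fun w => (metricG X w * dx u w - metricF X w * dy u w) / areaDensity X w) =
      fun w => metricG X w / areaDensity X w * dx u w - metricF X w / areaDensity X w * dy u w := by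
    ext w; ring
  have e2 : (fun w => (metricE X w * dy u w - metricF X w * dx u w) / areaDensity X w) =
      fun w => metricE X w / areaDensity X w * dy u w - metricF X w / areaDensity X w * dx u w := by
    ext w; ring
  have h1 := fderiv_mul_sub_mul hda hx hdb hy 1
  have h2 := fderiv_mul_sub_mul hdc hy hdb hx Complex.I
  unfold laplaceBeltrami beltramiOperator
  rw [e1, e2]
  congr 1
  simp only [smul_eq_mul]
  simp only [dx, dy] at h1 h2 ⊢
  rw [h1, h2]
  ring

theorem beltramiOperator_sub {u v : ℂ → ℝ} (hu : ContDiffAt ℝ 2 u z) (hv : ContDiffAt ℝ 2 v z) :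
    beltramiOperator X (fun w => u w - v w) z =
      beltramiOperator X u z - beltramiOperator X v z := by
  have h1 : ∀ᶠ w in 𝓝 z, ∀ d, fderiv ℝ (fun w => u w - v w) w d =
      fderiv ℝ u w d - fderiv ℝ v w d := by
    filter_upwards [hu.eventually (by simp), hv.eventually (by simp)] with w hw hw' d
    rw [fderiv_fun_sub (hw.differentiableAt two_ne_zero) (hw'.differentiableAt two_ne_zero)]; rfl
  have h2 : ∀ d d', fderiv ℝ (fun w => fderiv ℝ (fun w => u w - v w) w d) z d' =
      fderiv ℝ (fun w => fderiv ℝ u w d) z d' - fderiv ℝ (fun w => fderiv ℝ v w d) z d' := by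
    intro d d'
    have : (fun w => fderiv ℝ (fun w => u w - v w) w d) =ᶠ[𝓝 z]
        fun w => fderiv ℝ u w d - fderiv ℝ v w d := h1.mono fun w hw => hw d
    rw [this.fderiv_eq, fderiv_fun_sub]
    · rfl
    · exact ((hu.fderiv_right (m := 1) (by norm_num)).clm_apply contDiffAt_const).differentiableAt
        one_ne_zero
    · exact ((hv.fderiv_right (m := 1) (by norm_num)).clm_apply contDiffAt_const).differentiableAt
        one_ne_zero
  have h3 := h1.self_of_nhds
  unfold beltramiOperator
  simp only [smul_eq_mul]
  have e1 : ∀ u : ℂ → ℝ, dx (dx u) z = fderiv ℝ (fun w => fderiv ℝ u w 1) z 1 := fun _ => rfl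
  have e2 : ∀ u : ℂ → ℝ, dx (dy u) z = fderiv ℝ (fun w => fderiv ℝ u w Complex.I) z 1 :=
    fun _ => rfl
  have e3 : ∀ u : ℂ → ℝ, dy (dx u) z = fderiv ℝ (fun w => fderiv ℝ u w 1) z Complex.I :=
    fun _ => rfl
  have e4 : ∀ u : ℂ → ℝ, dy (dy u) z = fderiv ℝ (fun w => fderiv ℝ u w Complex.I) z Complex.I :=
    fun _ => rfl
  have e5 : dx (fun w => u w - v w) z = dx u z - dx v z := h3 1
  have e6 : dy (fun w => u w - v w) z = dy u z - dy v z := h3 Complex.I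
  rw [e1, e2, e3, e4, h2, h2, h2, h2, e5, e6, e1, e2, e3, e4, e1, e2, e3, e4]
  ring

/-- `Δ(⟨l, X⟩ + ε |X|²) = 4 ε` on a minimal surface. -/
theorem beltramiOperator_inner_add (hX : ContDiffAt ℝ 2 X z)
    (hinj : Function.Injective (fderiv ℝ X z)) (hmin : MeanCurvatureVanishes X z) (l : E)
    (c ε : ℝ) : beltramiOperator X (fun w => inner ℝ l (X w) - c + ε * inner ℝ (X w) (X w)) z =
      4 * ε * areaDensity X z := by
  have h1 : ∀ᶠ w in 𝓝 z, ∀ d, fderiv ℝ (fun w => inner ℝ l (X w) - c + ε * inner ℝ (X w) (X w)) w d =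
      inner ℝ (l + (2 * ε) • X w) (fderiv ℝ X w d) := by
    filter_upwards [hX.eventually (by simp)] with w hw d
    have hd := hw.differentiableAt two_ne_zero
    have h2 := fderiv_inner_eq hd hd d
    have h3 := fderiv_inner_eq (differentiableAt_const l) hd d
    have hd1 : DifferentiableAt ℝ (fun w => inner ℝ l (X w)) w := (differentiableAt_const l).inner ℝ hd
    have hd2 : DifferentiableAt ℝ (fun w => inner ℝ (X w) (X w)) w := hd.inner ℝ hd
    rw [fderiv_fun_add (hd1.sub_const c) (hd2.const_mul ε), fderiv_sub_const,
      fderiv_const_mul hd2, add_apply, smul_apply, h2, h3, inner_add_left, real_inner_smul_left,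
      (real_inner_comm _ _ : inner ℝ (fderiv ℝ X w d) (X w) = inner ℝ (X w) (fderiv ℝ X w d))]
    simp
    ring
  have h2 : ∀ d d', fderiv ℝ
      (fun w => fderiv ℝ (fun w => inner ℝ l (X w) - c + ε * inner ℝ (X w) (X w)) w d) z d' =
      inner ℝ (l + (2 * ε) • X z) (fderiv ℝ (fun w => fderiv ℝ X w d) z d') +
        2 * ε * inner ℝ (fderiv ℝ X z d') (fderiv ℝ X z d) := by
    intro d d'
    have : (fun w => fderiv ℝ (fun w => inner ℝ l (X w) - c + ε * inner ℝ (X w) (X w)) w d) =ᶠ[𝓝 z]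
        fun w => inner ℝ (l + (2 * ε) • X w) (fderiv ℝ X w d) := h1.mono fun w hw => hw d
    have hd := hX.differentiableAt two_ne_zero
    rw [this.fderiv_eq, fderiv_inner_eq ((hd.fun_const_smul _).const_add l), fderiv_const_add,
      fderiv_fun_const_smul hd, smul_apply, real_inner_smul_left]
    exact ((hX.fderiv_right (m := 1) (by norm_num)).clm_apply contDiffAt_const).differentiableAt
      one_ne_zero
  have h3 := h1.self_of_nhds
  have hself := congrArg (fun v => inner ℝ (l + (2 * ε) • X z) v) (beltramiOperator_self hX hinj hmin)
  unfold beltramiOperator at hself ⊢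
  simp only [smul_eq_mul, inner_add_right (𝕜 := ℝ), inner_sub_right, real_inner_smul_right,
    inner_zero_right] at hself ⊢
  have e1 : ∀ u : ℂ → ℝ, dx (dx u) z = fderiv ℝ (fun w => fderiv ℝ u w 1) z 1 := fun _ => rfl
  have e2 : ∀ u : ℂ → ℝ, dx (dy u) z = fderiv ℝ (fun w => fderiv ℝ u w Complex.I) z 1 :=
    fun _ => rfl
  have e3 : ∀ u : ℂ → ℝ, dy (dx u) z = fderiv ℝ (fun w => fderiv ℝ u w 1) z Complex.I :=
    fun _ => rfl
  have e4 : ∀ u : ℂ → ℝ, dy (dy u) z = fderiv ℝ (fun w => fderiv ℝ u w Complex.I) z Complex.I :=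
    fun _ => rfl
  have e5 : dx (fun w => inner ℝ l (X w) - c + ε * inner ℝ (X w) (X w)) z =
    inner ℝ (l + (2 * ε) • X z) (dx X z) := h3 1
  have e6 : dy (fun w => inner ℝ l (X w) - c + ε * inner ℝ (X w) (X w)) z =
    inner ℝ (l + (2 * ε) • X z) (dy X z) := h3 Complex.I
  have f1 : inner ℝ (fderiv ℝ X z 1) (fderiv ℝ X z 1) = metricE X z := rfl
  have f2 : inner ℝ (fderiv ℝ X z 1) (fderiv ℝ X z Complex.I) = metricF X z := rfl
  have f3 : inner ℝ (fderiv ℝ X z Complex.I) (fderiv ℝ X z Complex.I) = metricG X z := rfl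
  have f4 : inner ℝ (fderiv ℝ X z Complex.I) (fderiv ℝ X z 1) = metricF X z := real_inner_comm _ _
  rw [e1, e2, e3, e4, h2, h2, h2, h2, e5, e6, f1, f2, f3, f4]
  have hW := areaDensity_pos hinj
  have hsq := areaDensity_sq hW
  -- The terms paired with `l + 2εX` vanish by harmonicity of `X`. What remains is `2ε (GE - 2F² +
  -- EG) / W = 4εW`.
  have hW2 : areaDensity X z =
      (metricE X z * metricG X z - metricF X z ^ 2) / areaDensity X z := by
    rw [← hsq]; field_simp
  have g1 : ∀ v : E, inner ℝ (l + (2 * ε) • X z) v = inner ℝ l v + 2 * ε * inner ℝ (X z) v := by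
    intro v; rw [inner_add_left, real_inner_smul_left]
  have k1 : dx (dx X) z = fderiv ℝ (fun w => fderiv ℝ X w 1) z 1 := rfl
  have k2 : dx (dy X) z = fderiv ℝ (fun w => fderiv ℝ X w Complex.I) z 1 := rfl
  have k3 : dy (dx X) z = fderiv ℝ (fun w => fderiv ℝ X w 1) z Complex.I := rfl
  have k4 : dy (dy X) z = fderiv ℝ (fun w => fderiv ℝ X w Complex.I) z Complex.I := rfl
  rw [k1, k2, k3, k4] at hself
  simp only [inner_add_left] at hself ⊢
  linear_combination hself - 4 * ε * hW2

/-- First-order terms vanish at a maximum. Completing the square, `G W` times the operator is the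
Hessian evaluated on `(G, -F)` plus `(EG - F²) v_yy`, both nonpositive. -/
theorem beltramiOperator_nonpos_of_isLocalMax (hinj : Function.Injective (fderiv ℝ X z))
    {v : ℂ → ℝ} (hv : ContDiffAt ℝ 2 v z) (hmax : IsLocalMax v z) :
    beltramiOperator X v z ≤ 0 := by
  have h0 : ∀ d, fderiv ℝ v z d = 0 := fun d => by rw [hmax.fderiv_eq_zero]; rfl
  have ex : dx v z = 0 := h0 1
  have ey : dy v z = 0 := h0 Complex.I
  have hx : DifferentiableAt ℝ (dx v) z :=
    (contDiffAt_dx (m := 1) hv (by norm_num)).differentiableAt one_ne_zero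
  have hy : DifferentiableAt ℝ (dy v) z :=
    (contDiffAt_dy (m := 1) hv (by norm_num)).differentiableAt one_ne_zero
  have hess : ∀ s t : ℝ, s * (s * dx (dx v) z + t * dy (dx v) z) +
      t * (s * dx (dy v) z + t * dy (dy v) z) ≤ 0 := by
    intro s t
    have := hessian_nonpos_of_isLocalMax hv hmax (s + t * Complex.I)
    have e : (fun w => fderiv ℝ v w (s + t * Complex.I)) = fun w => s * dx v w + t * dy v w := by
      ext w; rw [fderiv_apply_eq]; simp
    rw [e, fderiv_fun_add (hx.const_mul s) (hy.const_mul t), fderiv_const_mul hx,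
      fderiv_const_mul hy, add_apply, smul_apply, smul_apply, fderiv_apply_eq, fderiv_apply_eq] at this
    simpa using this
  have h1 := hess (metricG X z) (-metricF X z)
  have h2 := hess 0 1
  obtain ⟨hE, hG, hdet⟩ := metric_det_pos hinj
  have hW := areaDensity_pos hinj
  have key : metricG X z * areaDensity X z * beltramiOperator X v z ≤ 0 := by
    have : metricG X z * areaDensity X z * beltramiOperator X v z =
        (metricG X z * (metricG X z * dx (dx v) z + (-metricF X z) * dy (dx v) z) +
          (-metricF X z) * (metricG X z * dx (dy v) z + (-metricF X z) * dy (dy v) z)) +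
        (metricE X z * metricG X z - metricF X z ^ 2) * dy (dy v) z := by
      unfold beltramiOperator
      rw [ex, ey]
      simp only [smul_eq_mul]
      field_simp
      ring
    rw [this]
    have : dy (dy v) z ≤ 0 := by linarith
    nlinarith
  by_contra! h
  have : 0 < metricG X z * areaDensity X z * beltramiOperator X v z := by positivity
  linarith

/-- The maximum principle for the difference of a coordinate function of a minimal surface and a
harmonic function. -/
theorem inner_sub_le_of_laplaceBeltrami_eq_zero {c : ℂ} {r : ℝ}
    (hXc : ContinuousOn X (closedBall c r)) (hX : ∀ z ∈ ball c r, ContDiffAt ℝ 2 X z)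
    (hinj : ∀ z ∈ ball c r, Function.Injective (fderiv ℝ X z))
    (hmin : ∀ z ∈ ball c r, MeanCurvatureVanishes X z) {h : ℂ → ℝ}
    (hhc : ContinuousOn h (closedBall c r)) (hh : ContDiffOn ℝ 2 h (ball c r))
    (hLB : ∀ z ∈ ball c r, laplaceBeltrami X h z = 0) {l : E} {m : ℝ}
    (hle : ∀ z ∈ sphere c r, inner ℝ l (X z) - m ≤ h z) :
    ∀ z ∈ ball c r, inner ℝ l (X z) - m ≤ h z := by
  intro z₁ hz₁
  by_contra! hlt
  have hsqc : ContinuousOn (fun w => inner ℝ (X w) (X w)) (closedBall c r) := hXc.inner hXc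
  obtain ⟨Q, hQ⟩ := ((isCompact_closedBall c r).image_of_continuousOn hsqc).bddAbove
  have hQ : ∀ z ∈ closedBall c r, inner ℝ (X z) (X z) ≤ Q := fun z hz =>
    hQ (mem_image_of_mem _ hz)
  have hQ0 : 0 ≤ Q := real_inner_self_nonneg.trans (hQ z₁ (ball_subset_closedBall hz₁))
  set δ := inner ℝ l (X z₁) - m - h z₁ with hδ
  have hδ0 : 0 < δ := sub_pos.2 hlt
  -- Adding `ε |X|²` makes the function strictly subharmonic; since `ε |X|² < δ` on the disc, the
  -- maximum of the difference is still attained in the interior.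
  set ε := δ / (Q + 1) with hε
  have hε0 : 0 < ε := by positivity
  have hεQ : ε * Q < δ := by
    rw [hε, div_mul_eq_mul_div, div_lt_iff₀ (by positivity)]; nlinarith
  set q : ℂ → ℝ := fun w => inner ℝ l (X w) - m + ε * inner ℝ (X w) (X w)
  set v : ℂ → ℝ := fun w => q w - h w with hv
  have hvc : ContinuousOn v (closedBall c r) :=
    (((continuousOn_const.inner hXc).sub continuousOn_const).add
      (continuousOn_const.mul hsqc)).sub hhc
  obtain ⟨z₀, hz₀, hmax⟩ := (isCompact_closedBall c r).exists_isMaxOn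
    ⟨z₁, ball_subset_closedBall hz₁⟩ hvc
  have h1 : δ ≤ v z₀ := by
    refine le_trans ?_ (hmax (ball_subset_closedBall hz₁))
    have : 0 ≤ ε * inner ℝ (X z₁) (X z₁) := mul_nonneg hε0.le real_inner_self_nonneg
    simp only [hv, q]; linarith
  have hz₀b : z₀ ∈ ball c r := by
    rw [← ball_union_sphere] at hz₀
    refine hz₀.resolve_right fun hs => ?_
    have h2 := hle z₀ hs
    have h3 : ε * inner ℝ (X z₀) (X z₀) ≤ ε * Q := by
      gcongr; exact hQ _ (sphere_subset_closedBall hs)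
    simp only [hv, q] at h1; linarith
  have hlm : IsLocalMax v z₀ := hmax.isLocalMax (mem_of_superset (isOpen_ball.mem_nhds hz₀b)
    ball_subset_closedBall)
  have hX0 := hX z₀ hz₀b
  have hh0 : ContDiffAt ℝ 2 h z₀ := hh.contDiffAt (isOpen_ball.mem_nhds hz₀b)
  have hq0 : ContDiffAt ℝ 2 q z₀ :=
    ((contDiffAt_const.inner ℝ hX0).sub contDiffAt_const).add
      (contDiffAt_const.mul (hX0.inner ℝ hX0))
  have h4 := beltramiOperator_nonpos_of_isLocalMax (hinj z₀ hz₀b) (hq0.sub hh0) hlm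
  have hW := areaDensity_pos (hinj z₀ hz₀b)
  have h5 : beltramiOperator X h z₀ = 0 := by
    have := hLB z₀ hz₀b
    rw [laplaceBeltrami_eq hX0 (hinj z₀ hz₀b) hh0] at this
    exact (mul_eq_zero.1 this).resolve_left (inv_pos.2 hW).ne'
  have h6 : beltramiOperator X v z₀ = beltramiOperator X q z₀ - beltramiOperator X h z₀ :=
    beltramiOperator_sub hq0 hh0
  have h7 : beltramiOperator X v z₀ ≤ 0 := h4
  rw [h6, h5, beltramiOperator_inner_add hX0 (hinj z₀ hz₀b) (hmin z₀ hz₀b)] at h7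
  have : 0 < 4 * ε * areaDensity X z₀ := by positivity
  linarith

end Comparison

/-! ### Bounded linear functions on parabolic minimal surfaces. -/

section Surface

variable {E : Type*} [NormedAddCommGroup E] [InnerProductSpace ℝ E]
variable {R : Type*} [TopologicalSpace R] [ChartedSpace ℂ R] [IsManifold 𝓘(ℝ, ℂ) ∞ R] {f : R → E}

theorem IsMinimalImmersion.contDiffOn_chart (hf : IsMinimalImmersion f)
    {e : OpenPartialHomeomorph R ℂ} (he : e ∈ atlas ℂ R) :
    ContDiffOn ℝ ∞ (f ∘ e.symm) e.target := by
  rw [← contMDiffOn_iff_contDiffOn]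
  exact hf.smooth.comp_contMDiffOn
    (contMDiffOn_symm_of_mem_maximalAtlas (IsManifold.subset_maximalAtlas he))

theorem IsMinimalImmersion.injective_fderiv_chart (hf : IsMinimalImmersion f)
    {e : OpenPartialHomeomorph R ℂ} (he : e ∈ atlas ℂ R) {z : ℂ} (hz : z ∈ e.target) :
    Function.Injective (fderiv ℝ (f ∘ e.symm) z) := by
  have : IsManifold 𝓘(ℝ, ℂ) 1 R := IsManifold.of_le (n := ∞) (by simp)
  have hmd := (mdifferentiable_of_mem_atlas (I := 𝓘(ℝ, ℂ)) he)
  have h1 : MDifferentiableAt 𝓘(ℝ, ℂ) 𝓘(ℝ, ℂ) e.symm z := hmd.symm.mdifferentiableAt hz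
  have h2 : MDifferentiableAt 𝓘(ℝ, ℂ) 𝓘(ℝ, E) f (e.symm z) :=
    hf.smooth.mdifferentiable (by simp) _
  have h3 := mfderiv_comp z h2 h1
  rw [mfderiv_eq_fderiv] at h3
  rw [h3]
  exact (hf.immersion _).comp (hmd.symm.mfderiv_injective hz)

/-- A coordinate function of a minimal immersion that is bounded above is constant if the surface
is parabolic. -/
theorem IsMinimalImmersion.inner_eq_of_isParabolic (hf : IsMinimalImmersion f)
    (hpar : IsParabolic f) {l : E} {m : ℝ} (hl : ∀ x, inner ℝ l (f x) < m) (x y : R) :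
    inner ℝ l (f x) = inner ℝ l (f y) := by
  have hc : Continuous fun x => inner ℝ l (f x) - m :=
    (continuous_const.inner hf.smooth.continuous).sub continuous_const
  obtain ⟨C, hC⟩ := hpar (fun x => ((inner ℝ l (f x) - m : ℝ) : EReal))
    ⟨fun x => EReal.coe_lt_top _, (continuous_coe_real_ereal.comp hc).upperSemicontinuous,
      fun e he c r hr hsub h hhc hh hLB hle z hz => by
        have hsm := hf.contDiffOn_chart he
        have hsub' := ball_subset_closedBall.trans hsub
        have h2 : ∀ z ∈ ball c r, ContDiffAt ℝ 2 (f ∘ e.symm) z := fun z hz =>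
          contDiffAt_infty.1 (hsm.contDiffAt (e.open_target.mem_nhds (hsub' hz))) 2
        have := inner_sub_le_of_laplaceBeltrami_eq_zero (hsm.continuousOn.mono hsub) h2
          (fun z hz => hf.injective_fderiv_chart he (hsub' hz))
          (fun z hz => hf.minimal e he z (hsub' hz)) hhc hh hLB (l := l) (m := m)
          (fun z hz => by exact_mod_cast hle z hz) z hz
        exact_mod_cast this⟩
    (fun x => by
      have := hl x
      exact_mod_cast sub_neg.2 this)
  have h1 : inner ℝ l (f x) - m = inner ℝ l (f y) - m := by
    exact_mod_cast (hC x).trans (hC y).symm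
  linarith

end Surface

/-- All barrier functionals are constant along the surface, so its tangent plane at any point,
two-dimensional because the map is an immersion, lies in their common kernel. -/
theorem not_containsParabolicMinimalSurface {E : Type*} [NormedAddCommGroup E]
    [InnerProductSpace ℝ E] [CompleteSpace E] {Ω : Set E} (hopen : IsOpen Ω)
    (hconvex : Convex ℝ Ω) (hP : ¬ ContainsAffinePlane Ω) :
    ¬ ContainsParabolicMinimalSurface Ω := by
  rintro ⟨R, _, _, _, _, _, _, f, hf, hpar, hΩ⟩
  obtain ⟨x⟩ := (inferInstance : Nonempty R)
  set e := chartAt ℂ x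
  have he : e ∈ atlas ℂ R := chart_mem_atlas ℂ x
  have hz : e x ∈ e.target := mem_chart_target ℂ x
  set X := f ∘ e.symm
  have hinj : Function.Injective (fderiv ℝ X (e x)) := hf.injective_fderiv_chart he hz
  have hd : DifferentiableAt ℝ X (e x) :=
    ((hf.contDiffOn_chart he).contDiffAt (e.open_target.mem_nhds hz)).differentiableAt (by simp)
  have horth : ∀ d, ∀ l ∈ barrier Ω, inner ℝ l (fderiv ℝ X (e x) d) = 0 := by
    rintro d l ⟨m, hm⟩
    have hconst : (fun w => inner ℝ l (X w)) = fun _ => inner ℝ l (f x) := by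
      ext w
      exact hf.inner_eq_of_isParabolic hpar (fun y => hm _ (hΩ y)) _ _
    have := fderiv_inner_eq (differentiableAt_const l) hd d
    rw [hconst] at this
    simpa using this.symm
  refine linearIndependent_orthogonal_barrier hopen hconvex ⟨f x, hΩ x⟩ hP (horth 1)
    (horth Complex.I) ?_
  have := Complex.basisOneI.linearIndependent.map' (fderiv ℝ X (e x) : ℂ →ₗ[ℝ] E)
    (LinearMap.ker_eq_bot.2 hinj)
  have hbasis : (fderiv ℝ X (e x) : ℂ →ₗ[ℝ] E) ∘ Complex.basisOneI =
      ![fderiv ℝ X (e x) 1, fderiv ℝ X (e x) Complex.I] := by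
    ext i
    fin_cases i <;> simp
  rw [hbasis] at this
  exact this

/-! ### Maximum principles and Liouville's theorem for upper semicontinuous subharmonic functions.
-/

section Liouville

/-- `u` lies below every harmonic function on a closed disc that lies above it on the boundary. -/
def BelowHarmonic (u : ℂ → EReal) (U : Set ℂ) : Prop :=
  ∀ (c : ℂ) (r : ℝ), 0 < r → closedBall c r ⊆ U → ∀ h : ℂ → ℝ,
    InnerProductSpace.HarmonicOnNhd h (closedBall c r) →
      (∀ z ∈ sphere c r, u z ≤ (h z : EReal)) → ∀ z ∈ ball c r, u z ≤ (h z : EReal)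

theorem re_add_div_sub (ξ w : ℂ) :
    ((ξ + w) / (ξ - w)).re = (‖ξ‖ ^ 2 - ‖w‖ ^ 2) / ‖ξ - w‖ ^ 2 := by
  rw [Complex.div_re, ← Complex.normSq_eq_norm_sq, ← Complex.normSq_eq_norm_sq,
    ← Complex.normSq_eq_norm_sq, ← add_div]
  congr 1
  simp [Complex.normSq_apply]
  ring

/-- A harmonic function on a neighbourhood of a closed disc that is positive at the centre,
nonpositive on the boundary away from a given boundary point, and bounded by `1` there. -/
theorem exists_harmonic_peak {c z₁ : ℂ} {r ρ : ℝ} (hr : 0 < r) (hz₁ : z₁ ∈ sphere c r)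
    (hρ : 0 < ρ) :
    ∃ φ : ℂ → ℝ, InnerProductSpace.HarmonicOnNhd φ (closedBall c r) ∧ 0 < φ c ∧
      (∀ z ∈ sphere c r, φ z ≤ 1) ∧ ∀ z ∈ sphere c r, ρ ≤ dist z z₁ → φ z ≤ 0 := by
  wlog hρr : ρ ≤ r generalizing ρ
  · obtain ⟨φ, h1, h2, h3, h4⟩ := this (lt_min hρ hr) (min_le_right ρ r)
    exact ⟨φ, h1, h2, h3, fun z hz h => h4 z hz ((min_le_left _ _).trans h)⟩
  -- `P` below is a Poisson kernel with its pole moved just outside the disc, to `c + (1 + s)(z₁ -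
  -- c)`. It equals `1` at `c`. On the circle it is at most `K = (2 + s) / s`, the pole being at
  -- distance at least `s r`; at distance `≥ ρ` from `z₁` it is at most `3 s r² / (ρ/2)² = 1/2`,
  -- which fixes `s`. Hence `(P - 1/2) / K` is the required function.
  set s := ρ ^ 2 / (24 * r ^ 2) with hs
  have hs0 : 0 < s := by positivity
  have hsr : s * (24 * r ^ 2) = ρ ^ 2 := by rw [hs]; field_simp
  have hs1 : s ≤ 1 := by
    rw [hs, div_le_one (by positivity)]; nlinarith
  have hsρ : s * r ≤ ρ / 2 := by
    have : s * r * (24 * r) ≤ ρ / 2 * (24 * r) := by nlinarith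
    exact le_of_mul_le_mul_right this (by positivity)
  set ξ := (1 + s : ℝ) • (z₁ - c) with hξ
  have hn1 : ‖z₁ - c‖ = r := by rwa [mem_sphere_iff_norm] at hz₁
  have hnξ : ‖ξ‖ = (1 + s) * r := by
    rw [hξ, norm_smul, hn1, Real.norm_of_nonneg (by positivity)]
  have hlow : ∀ z ∈ closedBall c r, s * r ≤ ‖ξ - (z - c)‖ := fun z hz => by
    have h1 := norm_sub_norm_le ξ (z - c)
    rw [mem_closedBall_iff_norm] at hz
    rw [hnξ] at h1; nlinarith
  have hne : ∀ z ∈ closedBall c r, ξ - (z - c) ≠ 0 := fun z hz h => by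
    have := hlow z hz
    rw [h, norm_zero] at this
    exact absurd this (not_le.2 (by positivity))
  set P : ℂ → ℝ := fun z => ((ξ + (z - c)) / (ξ - (z - c))).re with hP
  have hPh : InnerProductSpace.HarmonicOnNhd P (closedBall c r) := fun z hz => by
    have : AnalyticAt ℂ (fun z => (ξ + (z - c)) / (ξ - (z - c))) z := by
      refine AnalyticAt.div ?_ ?_ (hne z hz) <;> fun_prop
    exact this.harmonicAt_re
  have hPs : ∀ z ∈ sphere c r, P z = (2 * s + s ^ 2) * r ^ 2 / ‖ξ - (z - c)‖ ^ 2 := fun z hz => by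
    rw [mem_sphere_iff_norm] at hz
    rw [hP]
    simp only [re_add_div_sub, hz, hnξ]
    congr 1; ring
  have hPc : P c = 1 := by
    have : ξ ≠ 0 := by
      rw [← norm_ne_zero_iff, hnξ]; positivity
    simp [hP, this]
  set K := (2 + s) / s with hK
  have hK0 : 0 < K := by positivity
  refine ⟨K⁻¹ • (P - fun _ => 1 / 2), (hPh.sub (InnerProductSpace.harmonicOnNhd_const _)).const_smul,
    ?_, fun z hz => ?_, fun z hz hd => ?_⟩
  · simp only [Pi.smul_apply, Pi.sub_apply, hPc, smul_eq_mul]; norm_num; exact hK0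
  · simp only [Pi.smul_apply, Pi.sub_apply, smul_eq_mul]
    rw [inv_mul_le_iff₀ hK0, mul_one]
    have : P z ≤ K := by
      have hl := hlow z (sphere_subset_closedBall hz)
      have hsr0 : 0 < s * r := by positivity
      rw [hPs z hz, hK, div_le_div_iff₀ (by have := hsr0.trans_le hl; positivity) hs0]
      have : (s * r) ^ 2 ≤ ‖ξ - (z - c)‖ ^ 2 := by gcongr
      nlinarith
    linarith
  · simp only [Pi.smul_apply, Pi.sub_apply, smul_eq_mul]
    refine mul_nonpos_of_nonneg_of_nonpos (by positivity) ?_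
    have hl : ρ / 2 ≤ ‖ξ - (z - c)‖ := by
      have e : ξ - (z - c) = s • (z₁ - c) - (z - z₁) := by
        rw [hξ, add_smul, one_smul]; ring
      have h1 := norm_sub_norm_le (z - z₁) (s • (z₁ - c))
      rw [norm_smul, hn1, Real.norm_of_nonneg hs0.le, ← dist_eq_norm] at h1
      rw [e, norm_sub_rev]; linarith
    have hpos : 0 < ‖ξ - (z - c)‖ := (half_pos hρ).trans_le hl
    rw [hPs z hz, sub_nonpos, div_le_iff₀ (by positivity)]
    have : (ρ / 2) ^ 2 ≤ ‖ξ - (z - c)‖ ^ 2 := by gcongr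
    nlinarith [mul_pos hs0 (pow_pos hr 2)]

/-- The strong maximum principle on a disc. -/
theorem BelowHarmonic.lt_center {u : ℂ → EReal} {U : Set ℂ} (hu : BelowHarmonic u U)
    (husc : UpperSemicontinuous u) {c z₁ : ℂ} {r : ℝ} (hr : 0 < r) (hU : closedBall c r ⊆ U)
    {g : ℂ → ℝ} (hg : InnerProductSpace.HarmonicOnNhd g (closedBall c r))
    (hle : ∀ z ∈ sphere c r, u z ≤ (g z : EReal)) (hz₁ : z₁ ∈ sphere c r)
    (hlt : u z₁ < (g z₁ : EReal)) : u c < (g c : EReal) := by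
  obtain ⟨y, hy1, hy2⟩ := EReal.lt_iff_exists_real_btwn.1 hlt
  have hy2 : y < g z₁ := by exact_mod_cast hy2
  set δ := (g z₁ - y) / 2 with hδ
  have hδ0 : 0 < δ := half_pos (sub_pos.2 hy2)
  have hgc : ContinuousAt g z₁ := (hg z₁ (sphere_subset_closedBall hz₁)).1.continuousAt
  have hnear : ∀ᶠ z in 𝓝 z₁, u z ≤ ((g z - δ : ℝ) : EReal) := by
    filter_upwards [husc z₁ y hy1, hgc.eventually (lt_mem_nhds (show y + δ < g z₁ by linarith))]
      with z h1 h2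
    exact h1.le.trans (by exact_mod_cast (by linarith))
  obtain ⟨ρ, hρ, hball⟩ := Metric.eventually_nhds_iff.1 hnear
  obtain ⟨φ, hφ, hφc, hφ1, hφ0⟩ := exists_harmonic_peak hr hz₁ hρ
  -- Lowering `g` by `δφ` keeps it above `u` on the circle, as there is room `δ` near `z₁` and `φ ≤
  -- 0` elsewhere, but strictly decreases it at the centre.
  have h := hu c r hr hU (g - δ • φ) (hg.sub hφ.const_smul) (fun z hz => ?_) c (mem_ball_self hr)
  · refine h.trans_lt ?_
    simp only [Pi.sub_apply, Pi.smul_apply, smul_eq_mul]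
    have := mul_pos hδ0 hφc
    exact_mod_cast (by linarith)
  · simp only [Pi.sub_apply, Pi.smul_apply, smul_eq_mul]
    rcases lt_or_ge (dist z z₁) ρ with hd | hd
    · refine (hball hd).trans ?_
      have := hφ1 z hz
      exact_mod_cast (by nlinarith)
    · refine (hle z hz).trans ?_
      have := hφ0 z hz hd
      exact_mod_cast (by nlinarith)

theorem ereal_add_neg_le_iff (x : EReal) (g m : ℝ) :
    x + ((-g : ℝ) : EReal) ≤ (m : EReal) ↔ x ≤ ((g + m : ℝ) : EReal) := by
  induction x with
  | bot => simp
  | top => simp [-EReal.coe_neg, -EReal.coe_add]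
  | coe x =>
    norm_cast
    constructor <;> intro h <;> linarith

theorem ereal_add_neg_lt_iff (x : EReal) (g m : ℝ) :
    x + ((-g : ℝ) : EReal) < (m : EReal) ↔ x < ((g + m : ℝ) : EReal) := by
  induction x with
  | bot => simp [-EReal.coe_neg, -EReal.coe_add, EReal.bot_lt_coe]
  | top => simp [-EReal.coe_neg, -EReal.coe_add]
  | coe x =>
    norm_cast
    constructor <;> intro h <;> linarith

/-- The maximum principle on a compact set. -/
theorem BelowHarmonic.le_of_le_boundary {u : ℂ → EReal} {A O : Set ℂ} (hu : BelowHarmonic u O)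
    (husc : UpperSemicontinuous u) (htop : ∀ z, u z < ⊤) (hA : IsCompact A) (hO : IsOpen O)
    (hOA : O ⊆ A) {g : ℂ → ℝ} (hg : InnerProductSpace.HarmonicOnNhd g O) (hgc : ContinuousOn g A)
    (hle : ∀ z ∈ A \ O, u z ≤ (g z : EReal)) : ∀ z ∈ A, u z ≤ (g z : EReal) := by
  intro w hw
  set v : ℂ → EReal := fun z => u z + ((-g z : ℝ) : EReal) with hv
  have hvusc : UpperSemicontinuousOn v A := by
    refine (husc.upperSemicontinuousOn A).add' ?_ fun x _ => ?_
    · exact (continuous_coe_real_ereal.comp_continuousOn hgc.neg).upperSemicontinuousOn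
    · exact EReal.continuousAt_add (Or.inr (EReal.coe_ne_bot _)) (Or.inr (EReal.coe_ne_top _))
  obtain ⟨z₂, hz₂, hmax⟩ := hvusc.exists_isMaxOn ⟨w, hw⟩ hA
  have key : v z₂ ≤ ((0 : ℝ) : EReal) := by
    by_contra! hpos
    have hvtop : v z₂ ≠ ⊤ := by
      rw [hv]; exact (EReal.add_lt_top (htop z₂).ne (EReal.coe_ne_top _)).ne
    obtain ⟨m, hm⟩ : ∃ m : ℝ, v z₂ = m := ⟨_, (EReal.coe_toReal hvtop hpos.ne_bot).symm⟩
    have hm0 : 0 < m := by rw [hm] at hpos; exact_mod_cast hpos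
    have hvm : ∀ z ∈ A, v z ≤ (m : EReal) := fun z hz => (hmax hz).trans hm.le
    have hSc : IsCompact {z ∈ A | (m : EReal) ≤ v z} := by
      obtain ⟨F, hF, hAF⟩ := upperSemicontinuousOn_iff_preimage_Ici.1 hvusc (m : EReal)
      have : {z ∈ A | (m : EReal) ≤ v z} = A ∩ F := by rw [← hAF]; rfl
      rw [this]
      exact hA.inter_right hF
    -- Among the maximum points, one of largest real part is chosen: any point to its right in `A`
    -- has a strictly smaller value, so the strong maximum principle applies on a small disc without
    -- any connectedness argument.
    obtain ⟨z₀, ⟨hz₀A, hz₀m⟩, hre⟩ := hSc.exists_isMaxOn ⟨z₂, hz₂, hm.ge⟩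
      Complex.continuous_re.continuousOn
    have hz₀O : z₀ ∈ O := by
      by_contra hz₀O
      have h1 := hle z₀ ⟨hz₀A, hz₀O⟩
      have h2 : v z₀ < (m : EReal) := by
        rw [hv]; simp only
        rw [ereal_add_neg_lt_iff]
        exact h1.trans_lt (by exact_mod_cast (by linarith))
      exact absurd hz₀m (not_le.2 h2)
    obtain ⟨r, hr, hball⟩ := Metric.nhds_basis_closedBall.mem_iff.1 (hO.mem_nhds hz₀O)
    have hz₁ : z₀ + r ∈ sphere z₀ r := by simp [abs_of_pos hr]
    have hz₁A : z₀ + r ∈ A := hOA (hball (sphere_subset_closedBall hz₁))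
    have hz₁lt : v (z₀ + r) < (m : EReal) := by
      by_contra! h
      have := hre (show z₀ + r ∈ {z ∈ A | (m : EReal) ≤ v z} from ⟨hz₁A, h⟩)
      simp at this
      linarith
    have hlt := hu.lt_center husc hr hball (g := g + fun _ => m)
      ((hg.mono hball).add (InnerProductSpace.harmonicOnNhd_const m))
      (fun z hz => (ereal_add_neg_le_iff _ _ _).1 (hvm z (hOA (hball (sphere_subset_closedBall hz)))))
      hz₁ ((ereal_add_neg_lt_iff _ _ _).1 hz₁lt)
    exact absurd hz₀m (not_le.2 ((ereal_add_neg_lt_iff _ _ _).2 hlt))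
  have := (ereal_add_neg_le_iff _ _ _).1 ((hmax hw).trans key)
  rwa [add_zero] at this

/-- Liouville's theorem for negative subharmonic functions on the plane. -/
theorem BelowHarmonic.eq_const {u : ℂ → EReal} (hu : BelowHarmonic u univ)
    (husc : UpperSemicontinuous u) (hneg : ∀ z, u z < 0) : ∃ c, ∀ z, u z = c := by
  have htop : ∀ z, u z < ⊤ := fun z => (hneg z).trans EReal.zero_lt_top
  -- A bound on the unit disc propagates to the plane: outside it `u` is compared with `m + ε log
  -- |z|`, and then `ε → 0`.
  have hbound : ∀ m : ℝ, (∀ z ∈ closedBall (0 : ℂ) 1, u z ≤ (m : EReal)) → ∀ z, u z ≤ (m : EReal) := by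
    intro m hm z
    rcases le_or_gt ‖z‖ 1 with hz | hz
    · exact hm z (by simpa using hz)
    have hlog : ∀ ε : ℝ, 0 < ε → u z ≤ ((m + ε * Real.log ‖z‖ : ℝ) : EReal) := by
      intro ε hε
      -- The outer radius exceeds `|z|` and satisfies `m + ε log S ≥ 0`, so negativity of `u` gives
      -- the comparison on the outer circle.
      set S := max (‖z‖ + 1) (Real.exp (-m / ε)) with hS
      have hS0 : 0 < S := lt_max_of_lt_right (Real.exp_pos _)
      have hSlog : 0 ≤ m + ε * Real.log S := by
        have h1 : -m / ε ≤ Real.log S := by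
          rw [Real.le_log_iff_exp_le hS0]; exact le_max_right _ _
        rw [div_le_iff₀ hε] at h1; linarith
      set O := {w : ℂ | 1 < ‖w‖ ∧ ‖w‖ < S}
      set A := {w : ℂ | 1 ≤ ‖w‖ ∧ ‖w‖ ≤ S}
      have hOA : O ⊆ A := fun w hw => ⟨hw.1.le, hw.2.le⟩
      have hA : IsCompact A := by
        refine (isCompact_closedBall (0 : ℂ) S).of_isClosed_subset ?_ fun w hw => by
          simpa using hw.2
        exact (isClosed_le continuous_const continuous_norm).inter
          (isClosed_le continuous_norm continuous_const)
      have hO : IsOpen O := (isOpen_lt continuous_const continuous_norm).inter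
        (isOpen_lt continuous_norm continuous_const)
      have hne : ∀ w ∈ A, w ≠ 0 := fun w hw h => by
        have := hw.1; rw [h, norm_zero] at this; linarith
      have hgA : InnerProductSpace.HarmonicOnNhd
          ((fun _ => m) + ε • fun w : ℂ => Real.log ‖w‖) A := by
        refine (InnerProductSpace.harmonicOnNhd_const m).add
          (InnerProductSpace.HarmonicOnNhd.const_smul fun w hw => ?_)
        exact (analyticAt_id (𝕜 := ℂ) (z := w)).harmonicAt_log_norm (hne w hw)
      have := BelowHarmonic.le_of_le_boundary (u := u) (O := O) (A := A)
        (fun c r hr _ => hu c r hr (subset_univ _)) husc htop hA hO hOA (hgA.mono hOA)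
        hgA.continuousOn (fun w hw => ?_) z
        ⟨hz.le, ((le_max_left _ _).trans' (by linarith))⟩
      · exact this
      · simp only [Pi.add_apply, Pi.smul_apply, smul_eq_mul]
        rcases hw.1.1.eq_or_lt with h1 | h1
        · rw [← h1, Real.log_one, mul_zero, add_zero]
          exact hm w (by simp [← h1])
        · have h2 : ‖w‖ = S := le_antisymm hw.1.2 (not_lt.1 fun h => hw.2 ⟨h1, h⟩)
          rw [h2]
          exact (hneg w).le.trans (by exact_mod_cast hSlog)
    induction hx : u z with
    | bot => exact bot_le
    | top => exact absurd hx (htop z).ne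
    | coe x =>
      rw [EReal.coe_le_coe_iff]
      have hl : 0 < Real.log ‖z‖ := Real.log_pos hz
      refine le_of_forall_pos_le_add fun δ hδ => ?_
      have := hlog (δ / Real.log ‖z‖) (by positivity)
      rw [hx, div_mul_cancel₀ _ hl.ne'] at this
      exact_mod_cast this
  obtain ⟨z₀, hz₀, hmax⟩ := (husc.upperSemicontinuousOn (closedBall (0 : ℂ) 1)).exists_isMaxOn
    ⟨0, by simp⟩ (isCompact_closedBall 0 1)
  refine ⟨u z₀, fun z => ?_⟩
  induction hx : u z₀ with
  | bot =>
    refine EReal.eq_bot_iff_forall_lt _ |>.2 fun y => ?_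
    have := hbound (y - 1) (fun w hw => (hmax hw).trans (by rw [hx]; exact bot_le)) z
    exact this.trans_lt (by exact_mod_cast sub_one_lt y)
  | top => exact absurd hx (htop z₀).ne
  | coe M =>
    have hle := hbound M fun w hw => (hmax hw).trans hx.le
    refine le_antisymm (hle z) (not_lt.1 fun hlt => ?_)
    have hne : z ≠ z₀ := fun h => by rw [h, hx] at hlt; exact lt_irrefl _ hlt
    -- The global maximum `M` is attained at `z₀`; a point `z` with smaller value lies on a circle
    -- centred at `z₀`, against the strong maximum principle.
    have := hu.lt_center husc (dist_pos.2 hne) (subset_univ _)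
      (g := fun _ => M) (InnerProductSpace.harmonicOnNhd_const M) (fun w _ => hle w)
      (mem_sphere.2 rfl) hlt
    rw [hx] at this
    exact lt_irrefl _ this

end Liouville

/-! ### Affine planes are parabolic minimal surfaces. -/

section Plane

variable {E : Type*} [NormedAddCommGroup E] [InnerProductSpace ℝ E]

theorem laplacian_eq_dx_dx_add_dy_dy {h : ℂ → ℝ} {z : ℂ} (hh : ContDiffAt ℝ 2 h z) :
    Laplacian.laplacian h z = dx (dx h) z + dy (dy h) z := by
  have hd : DifferentiableAt ℝ (fderiv ℝ h) z :=
    (hh.fderiv_right (m := 1) (by norm_num)).differentiableAt one_ne_zero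
  have h1 : dx (dx h) z = fderiv ℝ (fderiv ℝ h) z 1 1 := by
    change fderiv ℝ (fun w => fderiv ℝ h w 1) z 1 = _
    rw [fderiv_clm_apply hd (differentiableAt_const (1 : ℂ))]; simp
  have h2 : dy (dy h) z = fderiv ℝ (fderiv ℝ h) z Complex.I Complex.I := by
    change fderiv ℝ (fun w => fderiv ℝ h w Complex.I) z Complex.I = _
    rw [fderiv_clm_apply hd (differentiableAt_const Complex.I)]; simp
  simp [InnerProductSpace.laplacian_eq_iteratedFDeriv_complexPlane, iteratedFDeriv_two_apply, h1, h2]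

variable {p e₁ e₂ : E}

theorem laplaceBeltrami_affineDisc (h₁ : ‖e₁‖ = 1) (h₂ : ‖e₂‖ = 1) (ho : inner ℝ e₁ e₂ = 0)
    (u : ℂ → ℝ) (z : ℂ) :
    laplaceBeltrami (affineDisc p e₁ e₂) u z = dx (dx u) z + dy (dy u) z := by
  have hE : metricE (affineDisc p e₁ e₂) = fun _ => 1 := by
    ext z; simp [metricE, h₁]
  have hG : metricG (affineDisc p e₁ e₂) = fun _ => 1 := by
    ext z; simp [metricG, h₂]
  have hF : metricF (affineDisc p e₁ e₂) = fun _ => 0 := by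
    ext z; simp [metricF, ho]
  have hW : areaDensity (affineDisc p e₁ e₂) = fun _ => 1 := by
    ext z; simp [areaDensity, hE, hF, hG]
  simp [laplaceBeltrami, hE, hF, hG, hW]

theorem isMinimalImmersion_affineDisc (h₁ : ‖e₁‖ = 1) (h₂ : ‖e₂‖ = 1) (ho : inner ℝ e₁ e₂ = 0) :
    IsMinimalImmersion (affineDisc p e₁ e₂) := by
  refine ⟨(contDiff_affineDisc p e₁ e₂).contMDiff, fun z => ?_, fun e he z _ => ?_⟩
  · rw [mfderiv_eq_fderiv, (hasFDerivAt_affineDisc p e₁ e₂ z).fderiv]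
    refine (injective_iff_map_eq_zero (Complex.reCLM.smulRight e₁ + Complex.imCLM.smulRight e₂)).2
      fun d hd => ?_
    have hd' : d.re • e₁ + d.im • e₂ = 0 := by simpa using hd
    have hr := congrArg (inner ℝ e₁) hd'
    have hi := congrArg (inner ℝ e₂) hd'
    rw [inner_add_right, inner_smul_right, inner_smul_right, inner_zero_right] at hr hi
    rw [ho, real_inner_self_eq_norm_sq, h₁] at hr
    rw [real_inner_comm, ho, real_inner_self_eq_norm_sq, h₂] at hi
    apply Complex.ext
    · simpa using hr
    · simpa using hi
  · rw [chartedSpaceSelf_atlas] at he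
    subst he
    have : affineDisc p e₁ e₂ ∘ (OpenPartialHomeomorph.refl ℂ).symm = affineDisc p e₁ e₂ := rfl
    rw [this, MeanCurvatureVanishes]
    simp [dx, dy]

/-- In the identity chart, the only one, the induced metric is Euclidean and its Laplacian is the
usual one, so Liouville's theorem on `ℂ` applies. -/
theorem isParabolic_affineDisc (h₁ : ‖e₁‖ = 1) (h₂ : ‖e₂‖ = 1) (ho : inner ℝ e₁ e₂ = 0) :
    IsParabolic (affineDisc p e₁ e₂) := by
  intro u hu hneg
  refine BelowHarmonic.eq_const (fun c r hr _ h hh hle z hz => ?_) hu.upperSemicontinuous hneg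
  refine hu.le_harmonic (OpenPartialHomeomorph.refl ℂ) (by rw [chartedSpaceSelf_atlas]) c r hr
    (fun _ _ => trivial) h hh.continuousOn (hh.mono ball_subset_closedBall).contDiffOn
    (fun w hw => ?_) hle z hz
  have hw' := hh w (ball_subset_closedBall hw)
  have := laplaceBeltrami_affineDisc (p := p) h₁ h₂ ho h w
  rw [← laplacian_eq_dx_dx_add_dy_dy hw'.1, hw'.2.eq_of_nhds] at this
  exact this

theorem ContainsAffinePlane.containsParabolicMinimalSurface {Ω : Set E}
    (h : ContainsAffinePlane Ω) : ContainsParabolicMinimalSurface Ω := by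
  obtain ⟨p, e₁, e₂, h₁, h₂, ho, hΩ⟩ := h.exists_affineDisc
  exact ⟨ℂ, inferInstance, inferInstance, inferInstance, inferInstance, inferInstance,
    inferInstance, affineDisc p e₁ e₂, isMinimalImmersion_affineDisc h₁ h₂ ho,
    isParabolic_affineDisc h₁ h₂ ho, hΩ⟩

end Plane

end MinimalHyperbolicity

theorem proposition4p3 (n : ℕ) (hn : 3 ≤ n) (Ω : Set (EuclideanSpace ℝ (Fin n)))
    (hne : Ω.Nonempty) (hopen : IsOpen Ω) (hconvex : Convex ℝ Ω) :
    List.TFAE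
      [MinimalHyperbolicity.IsCompleteHyperbolic Ω,
        MinimalHyperbolicity.IsHyperbolic Ω,
        MinimalHyperbolicity.IsWeaklyHyperbolic Ω,
        ¬ MinimalHyperbolicity.ContainsAffinePlane Ω,
        ¬ MinimalHyperbolicity.ContainsParabolicMinimalSurface Ω] := by
  tfae_have 1 → 2 := fun h => h.1
  tfae_have 2 → 3 := fun h => h.isWeaklyHyperbolic
  tfae_have 3 → 4 := fun h => h.not_containsAffinePlane
  tfae_have 4 → 1 := MinimalHyperbolicity.isCompleteHyperbolic_of_not_containsAffinePlane
    (by rw [finrank_euclideanSpace_fin]; omega) hopen hconvex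
  tfae_have 4 → 5 := MinimalHyperbolicity.not_containsParabolicMinimalSurface hopen hconvex
  tfae_have 5 → 4 := fun h hP => h hP.containsParabolicMinimalSurface
  tfae_finish
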